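/- Write $\|\cdot\|$ for the Euclidean norm on $\mathbb R^n$ and the induced operator norm, and $p_Z$ for the standard Gaussian density on $\mathbb R^n$. For a symmetric positive definite matrix $\Sigma$ let $\phi_{\Sigma}$ be the density of $\mathcal N(0,\Sigma)$, and let $\mathcal G$ be the set of all densities $\phi_\Sigma * \mu$, where $\Sigma$ ranges over the symmetric positive definite $n\times n$ matrices and $\mu$ over the compactly supported probability measures on $\mathbb R^n$. For a probability density $p$ on $\mathbb R^n$, let $(p_t)_{t\ge 0}$ be the marginal densities of the variance-preserving (VP) diffusion $\mathrm dX_t=-\tfrac12 X_t\,\mathrm dt+\mathrm dW_t$, $X_0\sim p$, that is, $p_0=p$ and, for $t>0$, $$p_t(x)=\int_{\mathbb R^n} p(y)\,\phi_{(1-e^{-t})I_n}\bigl(x-e^{-t/2}y\bigr)\,\mathrm dy .$$ Let $s_t(x)=\nabla_x\log p_t(x)$ be the score, and consider the probability flow ODE $$\frac{\mathrm dx}{\mathrm dt}=v_t(x),\qquad v_t(x)=-\tfrac12 x-\tfrac12 s_t(x).$$ **Corollary.** Let $p_H:\mathbb R^n\to[0,\infty)$ be a probability density. Then for every $\varepsilon>0$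 there exist $p\in\mathcal G$ and $T>0$ such that the probability flow ODE with initial law $p$ has, for every initial value $x\in\mathbb R^n$ at time $0$, exactly one solution $t\mapsto\varphi_{0\to t}(x)$ on $[0,T]$, and the following hold: 1. $\varphi_{0\to T}:\mathbb R^n\to\mathbb R^n$ is a bi-Lipschitz $C^1$-diffeomorphism: it is a $C^1$ bijection with $C^1$ inverse, and there are constants $0<c\le C<\infty$ with $c\|x-y\|\le\|\varphi_{0\to T}(x)-\varphi_{0\to T}(y)\|\le C\|x-y\|$ for all $x,y\in\mathbb R^n$. 2. The scores of the VP marginals are uniformly Lipschitz on $[0,T]\times\mathbb R^n$: for every $t\in[0,T]$ the density $p_t$ is positive and differentiable, $s_t$ is differentiable on $\mathbb R^n$, and $$\sup_{t\in[0,T]}\ \sup_{x\in\mathbb R^n}\|\nabla_x s_t(x)\|<\infty .$$ 3. The push-forward $(\varphi_{0\to T}^{-1})_\# p_Z$ of the standard Gaussian measure has a Lebesgue density, and, identifying it with this density, $$\bigl\|p_H-(\varphi_{0\to T}^{-1})_\# p_Z\bigr\|_{L^1(\mathbb R^n)}<\varepsilon .$$ -/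

import Mathlib

open MeasureTheory ProbabilityTheory Set
open scoped ENNReal

noncomputable section

namespace VPFlow

/-- The Euclidean space `ℝⁿ`, with its Euclidean norm and Lebesgue measure. -/
abbrev Rn (n : ℕ) : Type := EuclideanSpace ℝ (Fin n)

/-- `p` is a probability density function on `ℝⁿ` (with respect to Lebesgue measure). -/
structure IsPDF {n : ℕ} (p : Rn n → ℝ) : Prop where
  nonneg : ∀ x, 0 ≤ p x
  integrable : Integrable p volume
  integral_eq_one : ∫ x, p x = 1

/-- The density of the Gaussian `𝒩(0, S)` for a symmetric positive definite covariance `S`. -/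
def gaussianDensity {n : ℕ} (S : Matrix (Fin n) (Fin n) ℝ) (x : Rn n) : ℝ :=
  (2 * Real.pi) ^ (-(n : ℝ) / 2) * S.det ^ (-(1 : ℝ) / 2) *
    Real.exp (-(x.ofLp ⬝ᵥ (S⁻¹.mulVec x.ofLp)) / 2)

/-- The density of the isotropic Gaussian `𝒩(0, v I)` with variance `v > 0`. -/
def isoGaussianDensity {n : ℕ} (v : ℝ) (x : Rn n) : ℝ :=
  (2 * Real.pi * v) ^ (-(n : ℝ) / 2) * Real.exp (-‖x‖ ^ 2 / (2 * v))

/-- The class `𝒢` of the densities `φ_{S,0} ∗ μ`, with `S` symmetric positive definite and `μ` a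
compactly supported probability measure. -/
def GaussianConvolutions (n : ℕ) : Set (Rn n → ℝ) :=
  {p | ∃ (S : Matrix (Fin n) (Fin n) ℝ) (μ : Measure (Rn n)),
    S.PosDef ∧ IsProbabilityMeasure μ ∧ IsCompact μ.support ∧
      p = fun x => ∫ y, gaussianDensity S (x - y) ∂μ}

/-- The law at time `t` of the variance-preserving diffusion `dX = -½ X dt + dW` with `X₀ ∼ ν`:
that of `e^{-t/2} X₀ + √(1 - e^{-t}) Z` with `Z` standard Gaussian independent of `X₀`. -/
def vpLaw {n : ℕ} (ν : Measure (Rn n)) (t : ℝ) : Measure (Rn n) :=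
  (ν.prod (stdGaussian (Rn n))).map
    fun yz => Real.exp (-t / 2) • yz.1 + √(1 - Real.exp (-t)) • yz.2

/-- The marginal density `p_t` of the variance-preserving diffusion started from the density `p`:
`p₀ = p` and, for `t > 0`, `p_t(x) = ∫ p(y) φ_{1 - e^{-t}}(x - e^{-t/2} y) dy`. -/
def vpDensity {n : ℕ} (p : Rn n → ℝ) (t : ℝ) (x : Rn n) : ℝ :=
  if t ≤ 0 then p x
  else ∫ y, p y * isoGaussianDensity (1 - Real.exp (-t)) (x - Real.exp (-t / 2) • y)

/-- The score `s_t = ∇ log p_t` of the marginals. -/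
def score {n : ℕ} (p : Rn n → ℝ) (t : ℝ) : Rn n → Rn n :=
  gradient fun x => Real.log (vpDensity p t x)

/-- The velocity field `v_t(x) = -½ x - ½ s_t(x)` of the probability flow. -/
def velocity {n : ℕ} (p : Rn n → ℝ) (t : ℝ) (x : Rn n) : Rn n :=
  -(1 / 2 : ℝ) • x - (1 / 2 : ℝ) • score p t x

/-- `φ t = φ_{0→t}`, `t ∈ [0, T]`, is the flow of the probability flow ODE `x' = v_t(x)` with
initial law `p`: from every point there is exactly one solution on `[0, T]`, and `φ · x` is it. -/
structure IsProbabilityFlow {n : ℕ} (p : Rn n → ℝ) (T : ℝ) (φ : ℝ → Rn n → Rn n) : Prop where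
  initial : ∀ x, φ 0 x = x
  solution : ∀ x, IsIntegralCurveOn (fun t => φ t x) (velocity p) (Icc 0 T)
  unique : ∀ x (γ : ℝ → Rn n), γ 0 = x → IsIntegralCurveOn γ (velocity p) (Icc 0 T) →
    ∀ t ∈ Icc 0 T, γ t = φ t x

/-- `f` is a bi-Lipschitz `C¹`-diffeomorphism of `ℝⁿ`, with inverse `g`. -/
structure IsBiLipschitzC1Diffeo {n : ℕ} (f g : Rn n → Rn n) : Prop where
  left_inv : Function.LeftInverse g f
  right_inv : Function.RightInverse g f
  contDiff : ContDiff ℝ 1 f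
  contDiff_inv : ContDiff ℝ 1 g
  biLipschitz : ∃ c C : ℝ, 0 < c ∧ c ≤ C ∧
    ∀ x y, c * ‖x - y‖ ≤ ‖f x - f y‖ ∧ ‖f x - f y‖ ≤ C * ‖x - y‖

/-- The scores `s_t` of the marginals `p_t` started from `p` are well defined and differentiable
on `ℝⁿ` for all `t ∈ [0, T]`, and the operator norm of `∇ s_t(x)` is bounded on `[0, T] × ℝⁿ`. -/
def HasUniformlyLipschitzScores {n : ℕ} (p : Rn n → ℝ) (T : ℝ) : Prop :=
  (∀ t ∈ Icc 0 T, (∀ x, 0 < vpDensity p t x) ∧ Differentiable ℝ (vpDensity p t) ∧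
    Differentiable ℝ (score p t)) ∧
  ∃ M : ℝ, ∀ t ∈ Icc 0 T, ∀ x, ‖fderiv ℝ (score p t) x‖ ≤ M

/-- The measure with density `p` with respect to Lebesgue measure. -/
def measureOfDensity {n : ℕ} (p : Rn n → ℝ) : Measure (Rn n) :=
  volume.withDensity fun x => ENNReal.ofReal (p x)


theorem gaussianDensity_smul_one {n : ℕ} {v : ℝ} (hv : 0 < v) (x : Rn n) :
    gaussianDensity (v • (1 : Matrix (Fin n) (Fin n) ℝ)) x = isoGaussianDensity v x := by
  have h1 : (v • (1 : Matrix (Fin n) (Fin n) ℝ))⁻¹ = v⁻¹ • (1 : Matrix (Fin n) (Fin n) ℝ) := by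
    apply Matrix.inv_eq_right_inv
    simp [smul_smul, hv.ne']
  unfold gaussianDensity isoGaussianDensity
  rw [h1, Matrix.det_smul, Matrix.det_one, mul_one, Fintype.card_fin, Matrix.smul_mulVec,
    Matrix.one_mulVec, dotProduct_smul, Real.mul_rpow (by positivity) hv.le,
    EuclideanSpace.real_norm_sq_eq]
  congr 1
  · congr 1
    rw [← Real.rpow_natCast, ← Real.rpow_mul hv.le]
    congr 1; ring
  · congr 1
    simp only [dotProduct, smul_eq_mul, ← sq]
    field_simp

theorem isoGaussianDensity_nonneg {n : ℕ} {v : ℝ} (hv : 0 < v) (x : Rn n) :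
    0 ≤ isoGaussianDensity v x := by
  unfold isoGaussianDensity; positivity

theorem continuous_isoGaussianDensity {n : ℕ} (v : ℝ) :
    Continuous (isoGaussianDensity v : Rn n → ℝ) := by
  unfold isoGaussianDensity; fun_prop

theorem isoGaussianDensity_le {n : ℕ} {v : ℝ} (hv : 0 < v) (x : Rn n) :
    isoGaussianDensity v x ≤ (2 * Real.pi * v) ^ (-(n : ℝ) / 2) := by
  unfold isoGaussianDensity
  refine mul_le_of_le_one_right (by positivity) (Real.exp_le_one_iff.2 ?_)
  rw [neg_div, neg_nonpos]; positivity

theorem integrable_isoGaussianDensity {n : ℕ} {v : ℝ} (hv : 0 < v) :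
    Integrable (isoGaussianDensity v : Rn n → ℝ) := by
  have h := GaussianFourier.integrable_cexp_neg_mul_sq_norm_add (V := Rn n)
    (b := ((2 * v)⁻¹ : ℝ)) (by rw [Complex.ofReal_re]; positivity) 0 0
  have h2 := (h.norm).const_mul ((2 * Real.pi * v) ^ (-(n : ℝ) / 2))
  refine h2.congr (Filter.Eventually.of_forall fun x => ?_)
  simp only [isoGaussianDensity, Complex.norm_exp]
  congr 2
  simp [← Complex.ofReal_pow, ← Complex.ofReal_mul, div_eq_mul_inv]
  ring

theorem charFun_isoGaussianDensity {n : ℕ} {v : ℝ} (hv : 0 < v) (w : Rn n) :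
    charFun (measureOfDensity (isoGaussianDensity v)) w = Complex.exp (-(v * ‖w‖ ^ 2) / 2) := by
  rw [charFun_apply, measureOfDensity, integral_withDensity_eq_integral_toReal_smul
    (by exact ((continuous_isoGaussianDensity v).measurable).ennreal_ofReal) (by simp)]
  have hb : (0 : ℝ) < (2 * v)⁻¹ := by positivity
  have h := GaussianFourier.integral_cexp_neg_mul_sq_norm_add (V := Rn n)
    (b := ((2 * v)⁻¹ : ℝ)) (by rwa [Complex.ofReal_re]) Complex.I w
  have hC : (Real.pi / ((2 * v)⁻¹ : ℝ) : ℂ) ^ (Module.finrank ℝ (Rn n) / 2 : ℂ)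
      = (((2 * Real.pi * v) ^ ((n : ℝ) / 2) : ℝ) : ℂ) := by
    rw [Complex.ofReal_cpow (by positivity), finrank_euclideanSpace_fin]
    congr 1
    · push_cast; field_simp
    · push_cast; rfl
  have hI : ∀ x : Rn n, (ENNReal.ofReal (isoGaussianDensity v x)).toReal •
      Complex.exp (inner ℝ x w * Complex.I) =
      (((2 * Real.pi * v) ^ (-(n : ℝ) / 2) : ℝ) : ℂ) *
        Complex.exp (-((2 * v)⁻¹ : ℝ) * ‖x‖ ^ 2 + Complex.I * inner ℝ w x) := by
    intro x
    rw [ENNReal.toReal_ofReal (isoGaussianDensity_nonneg hv x), isoGaussianDensity,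
      Complex.exp_add, real_inner_comm x w, mul_comm Complex.I, Complex.real_smul]
    push_cast
    rw [mul_assoc]
    congr 3
    field_simp
  simp_rw [hI]
  rw [integral_const_mul, h, hC, ← mul_assoc, ← Complex.ofReal_mul,
    ← Real.rpow_add (by positivity), neg_div, neg_add_cancel, Real.rpow_zero, Complex.ofReal_one,
    one_mul, Complex.I_sq]
  congr 1
  push_cast
  field_simp
  ring

theorem isFiniteMeasure_isoGaussian {n : ℕ} {v : ℝ} (hv : 0 < v) :
    IsFiniteMeasure (measureOfDensity (isoGaussianDensity v : Rn n → ℝ)) :=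
  isFiniteMeasure_withDensity_ofReal (integrable_isoGaussianDensity hv).2

/-- The standard Gaussian measure scaled by `√v` has the density `isoGaussianDensity v`. -/
theorem map_smul_stdGaussian {n : ℕ} {v : ℝ} (hv : 0 < v) :
    (stdGaussian (Rn n)).map (fun z => √v • z) = measureOfDensity (isoGaussianDensity v) := by
  have := isFiniteMeasure_isoGaussian (n := n) hv
  apply Measure.ext_of_charFun
  ext w
  rw [charFun_map_smul, charFun_stdGaussian, charFun_isoGaussianDensity hv, norm_smul,
    Real.norm_of_nonneg (Real.sqrt_nonneg v), ← Complex.ofReal_pow, mul_pow,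
    Real.sq_sqrt hv.le]
  congr 1
  push_cast
  ring

theorem stdGaussian_eq {n : ℕ} :
    stdGaussian (Rn n) = measureOfDensity (isoGaussianDensity 1) := by
  simpa using map_smul_stdGaussian (n := n) one_pos

/-- `vpDensity p t` is the density of the law at time `t` of the diffusion started from `p`. -/
theorem vpLaw_eq {n : ℕ} {p : Rn n → ℝ} (hp : IsPDF p) {t : ℝ} (ht : 0 ≤ t) :
    vpLaw (measureOfDensity p) t = measureOfDensity (vpDensity p t) := by
  have hpm : AEMeasurable (fun y => ENNReal.ofReal (p y)) volume :=
    hp.integrable.aestronglyMeasurable.aemeasurable.ennreal_ofReal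
  have : SFinite (measureOfDensity p) := by unfold measureOfDensity; infer_instance
  rcases ht.eq_or_lt with rfl | ht
  · have h0 : vpDensity p 0 = p := by ext x; simp [vpDensity]
    rw [h0, vpLaw]
    simp only [neg_zero, zero_div, Real.exp_zero, one_smul, sub_self, Real.sqrt_zero, zero_smul,
      add_zero]
    exact Measure.fst_prod
  set s : ℝ := 1 - Real.exp (-t) with hs_def
  set a : ℝ := Real.exp (-t / 2) with ha_def
  have hs : 0 < s := by rw [hs_def, sub_pos, Real.exp_lt_one_iff]; linarith
  have hG : Measurable fun x : Rn n => ENNReal.ofReal (isoGaussianDensity s x) :=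
    (continuous_isoGaussianDensity s).measurable.ennreal_ofReal
  refine Measure.ext_of_lintegral _ fun f hf => ?_
  have hinner : ∀ y : Rn n, ∫⁻ z, f (a • y + √s • z) ∂(stdGaussian (Rn n)) =
      ∫⁻ x, ENNReal.ofReal (isoGaussianDensity s (x - a • y)) * f x := by
    intro y
    have h1 : ∫⁻ z, f (a • y + √s • z) ∂(stdGaussian (Rn n)) =
        ∫⁻ z, f (a • y + z) ∂((stdGaussian (Rn n)).map fun z => √s • z) := by
      rw [lintegral_map (by fun_prop) (by fun_prop)]
    rw [h1, map_smul_stdGaussian hs, measureOfDensity,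
      lintegral_withDensity_eq_lintegral_mul _ hG (by fun_prop),
      ← lintegral_sub_right_eq_self _ (a • y)]
    simp
  have hdens : ∀ x : Rn n, ENNReal.ofReal (vpDensity p t x) =
      ∫⁻ y, ENNReal.ofReal (p y) * ENNReal.ofReal (isoGaussianDensity s (x - a • y)) := by
    intro x
    have hc : Continuous fun y : Rn n => isoGaussianDensity s (x - a • y) :=
      (continuous_isoGaussianDensity s).comp (by fun_prop)
    rw [vpDensity, if_neg (not_le.2 ht), ofReal_integral_eq_lintegral_ofReal]
    · simp_rw [ENNReal.ofReal_mul (hp.nonneg _)]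
      rfl
    · refine hp.integrable.mul_bdd (c := (2 * Real.pi * s) ^ (-(n : ℝ) / 2))
        hc.aestronglyMeasurable (Filter.Eventually.of_forall fun y => ?_)
      rw [Real.norm_of_nonneg (isoGaussianDensity_nonneg hs _)]
      exact isoGaussianDensity_le hs _
    · exact Filter.Eventually.of_forall fun y =>
        mul_nonneg (hp.nonneg y) (isoGaussianDensity_nonneg hs _)
  have hjoint : AEMeasurable (fun q : Rn n × Rn n => ENNReal.ofReal (p q.2) *
      ENNReal.ofReal (isoGaussianDensity s (q.1 - a • q.2))) (volume.prod volume) := by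
    refine AEMeasurable.mul (hpm.comp_snd) (Measurable.aemeasurable ?_)
    exact hG.comp (by fun_prop)
  have hvm : AEMeasurable (fun x => ENNReal.ofReal (vpDensity p t x)) volume := by
    simp_rw [hdens]
    exact hjoint.lintegral_prod_right'
  rw [vpLaw, lintegral_map hf (by fun_prop), lintegral_prod _ (by fun_prop)]
  simp only [← hs_def, ← ha_def]
  simp_rw [hinner]
  have hGf : ∀ y : Rn n, Measurable fun x =>
      ENNReal.ofReal (isoGaussianDensity s (x - a • y)) * f x := fun y =>
    (hG.comp (by fun_prop)).mul hf
  have hGm : Measurable fun y => ∫⁻ x, ENNReal.ofReal (isoGaussianDensity s (x - a • y)) * f x := by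
    refine Measurable.lintegral_prod_right' (f := fun q : Rn n × Rn n =>
      ENNReal.ofReal (isoGaussianDensity s (q.2 - a • q.1)) * f q.2) ?_
    exact (hG.comp (by fun_prop)).mul (hf.comp measurable_snd)
  rw [measureOfDensity, measureOfDensity,
    lintegral_withDensity_eq_lintegral_mul₀ hpm hGm.aemeasurable,
    lintegral_withDensity_eq_lintegral_mul₀ hvm hf.aemeasurable]
  simp only [Pi.mul_apply, hdens]
  simp_rw [← lintegral_const_mul _ (hGf _)]
  rw [lintegral_lintegral_swap]
  · refine lintegral_congr fun x => ?_
    have h := lintegral_mul_const'' (f x)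
      (hpm.mul (hG.comp (by fun_prop : Measurable fun y : Rn n => x - a • y)).aemeasurable)
    simp only [Pi.mul_apply, Function.comp_apply] at h
    rw [← h]
    simp_rw [mul_assoc]
  · exact hpm.comp_fst.mul ((hG.comp (by fun_prop :
      Measurable fun q : Rn n × Rn n => q.2 - a • q.1)).mul (hf.comp measurable_snd)).aemeasurable

end VPFlow

end

/-! The `L¹` distance is invariant under diffeomorphisms. If the flow carries `p` to its marginal
`p_T`, the distance from `p` to the pulled-back Gaussian therefore equals the distance from `p_T` to
the Gaussian, which tends to zero as `T → ∞`. No stability estimate for the flow is needed; it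
suffices to approximate `p_H` by some `p` in the class whose flow is regular.

Take `p = φ_v * μ` with `v ≤ 1` and `μ` having a continuous compactly supported density near `p_H`.
Its marginals are again mixtures over `μ`, with variance `V = vpVar v t` and centres scaled by
`e^{-t/2}`. In the variables `z = x / √V` and `l = e^{-t/2} / √V` they become an exponential family
tilting `μ`, and the probability flow becomes `dz/dl = m(l, z)`, where `m` is the tilted mean
(`score_mixtureDensity`, `hasDerivAt_vpSignal`). Its spatial derivative is `l` times the tilted
covariance, which is bounded because `μ` has bounded support (`norm_tiltCov_le`). This bounds the
derivative of the score uniformly and makes the flow a bi-Lipschitz `C¹`-diffeomorphism.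

That the flow transports densities follows from the continuity equation
(`tiltDensity_continuity_equation`) and Liouville's formula (`continuity_equation_along_flow`). The
limits `v → 0` and `T → ∞` are pointwise and are upgraded to `L¹` by Scheffé's lemma
(`tendsto_integral_abs_sub_of_isPDF`). -/

namespace VPFlow

open scoped NNReal Topology

/-! ### Global flows of Lipschitz fields and their differentiability in the initial value. -/

section Ode

variable {E : Type*} [NormedAddCommGroup E] [NormedSpace ℝ E]

/-- The radial retraction of a normed space onto the closed ball of radius `R`. -/
noncomputable def radialRetraction (R : ℝ) (x : E) : E := (R / max R ‖x‖) • x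

theorem radialRetraction_of_norm_le {R : ℝ} (hR : 0 < R) {x : E} (hx : ‖x‖ ≤ R) :
    radialRetraction R x = x := by
  rw [radialRetraction, max_eq_left hx, div_self hR.ne', one_smul]

theorem norm_radialRetraction_le {R : ℝ} (hR : 0 < R) (x : E) :
    ‖radialRetraction R x‖ ≤ R ∧ ‖radialRetraction R x‖ ≤ ‖x‖ := by
  have hm : 0 < max R ‖x‖ := lt_max_of_lt_left hR
  have hn : ‖radialRetraction R x‖ = R / max R ‖x‖ * ‖x‖ := by
    rw [radialRetraction, norm_smul, Real.norm_of_nonneg (by positivity)]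
  rw [hn, div_mul_eq_mul_div]
  constructor
  · rw [div_le_iff₀ hm]
    exact mul_le_mul_of_nonneg_left (le_max_right _ _) hR.le
  · rw [div_le_iff₀ hm, mul_comm]
    exact mul_le_mul_of_nonneg_left (le_max_left _ _) (norm_nonneg _)

/-- The difference splits into a multiple of `x - y` and a multiple of `y` coming from the change of
the scaling factor; each has norm at most `‖x - y‖`. The constant 2 is what this gives in an
arbitrary normed space. -/
theorem norm_radialRetraction_sub_le {R : ℝ} (hR : 0 < R) (x y : E) :
    ‖radialRetraction R x - radialRetraction R y‖ ≤ 2 * ‖x - y‖ := by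
  set a := max R ‖x‖ with ha
  set b := max R ‖y‖ with hb
  have ha0 : 0 < a := lt_max_of_lt_left hR
  have hb0 : 0 < b := lt_max_of_lt_left hR
  have hab : |b - a| ≤ ‖x - y‖ := by
    have h1 : |max ‖y‖ R - max ‖x‖ R| ≤ |‖y‖ - ‖x‖| := abs_max_sub_max_le_abs _ _ _
    rw [max_comm ‖y‖, max_comm ‖x‖, ← ha, ← hb] at h1
    exact h1.trans ((abs_norm_sub_norm_le y x).trans_eq (norm_sub_rev y x))
  have hid : radialRetraction R x - radialRetraction R y =
      (R / a) • (x - y) + ((R / a) * ((b - a) / b)) • y := by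
    have : R / a * ((b - a) / b) = R / a - R / b := by field_simp
    rw [radialRetraction, radialRetraction, ← ha, ← hb, this]
    module
  have hRa : R / a ≤ 1 := (div_le_one ha0).2 (le_max_left _ _)
  have hRa0 : 0 ≤ R / a := by positivity
  rw [hid]
  refine (norm_add_le _ _).trans ?_
  rw [norm_smul, norm_smul, Real.norm_of_nonneg hRa0, norm_mul, Real.norm_of_nonneg hRa0,
    norm_div, Real.norm_of_nonneg hb0.le, Real.norm_eq_abs]
  have h1 : R / a * ‖x - y‖ ≤ ‖x - y‖ := mul_le_of_le_one_left (norm_nonneg _) hRa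
  have h2 : R / a * (|b - a| / b) * ‖y‖ ≤ ‖x - y‖ := by
    calc R / a * (|b - a| / b) * ‖y‖ ≤ 1 * (|b - a| / b) * b := by
          gcongr
          exact le_max_right _ _
      _ = |b - a| := by field_simp
      _ ≤ _ := hab
  linarith

/-- Grönwall's inequality for a curve on `[0, T]` with a derivative within `[0, T]`. -/
theorem norm_le_gronwallBound_Icc {f f' : ℝ → E} {δ K ε T : ℝ}
    (hf : ∀ t ∈ Icc 0 T, HasDerivWithinAt f (f' t) (Icc 0 T) t) (h0 : ‖f 0‖ ≤ δ)
    (bound : ∀ t ∈ Icc 0 T, ‖f' t‖ ≤ K * ‖f t‖ + ε) :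
    ∀ t ∈ Icc 0 T, ‖f t‖ ≤ gronwallBound δ K ε t := by
  intro t ht
  have := norm_le_gronwallBound_of_norm_deriv_right_le (a := 0) (b := T)
    (fun t ht => (hf t ht).continuousWithinAt)
    (fun t ht => (hf t (Ico_subset_Icc_self ht)).mono_of_mem_nhdsWithin
      (Icc_mem_nhdsGE_of_mem ht)) h0
    (fun t ht => bound t (Ico_subset_Icc_self ht)) t ht
  simpa using this

theorem gronwallBound_zero_eq_mul (K ε t : ℝ) :
    gronwallBound 0 K ε t = ε * gronwallBound 0 K 1 t := by
  by_cases hK : K = 0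
  · simp [hK, gronwallBound_K0]
  · simp [gronwallBound_of_K_ne_0 hK]; ring

theorem gronwallBound_nonneg {δ K ε t : ℝ} (hδ : 0 ≤ δ) (hK : 0 ≤ K) (hε : 0 ≤ ε) (ht : 0 ≤ t) :
    0 ≤ gronwallBound δ K ε t := by
  have := gronwallBound_mono hδ hε hK ht
  rw [gronwallBound_x0] at this
  exact hδ.trans this

/-- Global existence for an ordinary differential equation with a globally Lipschitz field. -/
theorem exists_isIntegralCurveOn_of_lipschitz [CompleteSpace E] {f : ℝ → E → E} {T : ℝ}
    (hT : 0 ≤ T) {K : ℝ≥0} (hf : ∀ t ∈ Icc 0 T, LipschitzWith K (f t))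
    (hc : ∀ x, ContinuousOn (f · x) (Icc 0 T)) (x₀ : E) :
    ∃ α : ℝ → E, α 0 = x₀ ∧ IsIntegralCurveOn α f (Icc 0 T) := by
  obtain ⟨B, hB⟩ := isCompact_Icc.exists_bound_of_continuousOn (hc 0)
  have hB0 : 0 ≤ B := (norm_nonneg _).trans (hB 0 ⟨le_rfl, hT⟩)
  -- `R` is the a priori Grönwall bound for solutions under the growth `K ‖x‖ + B`; the added 1
  -- makes it positive.
  set R : ℝ := gronwallBound ‖x₀‖ K B T + 1 with hR_def
  have hR : 0 < R := by
    have := gronwallBound_nonneg (norm_nonneg x₀) K.2 hB0 hT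
    positivity
  have hlin : ∀ t ∈ Icc 0 T, ∀ x, ‖f t x‖ ≤ K * ‖x‖ + B := by
    intro t ht x
    have h1 := (hf t ht).dist_le_mul x 0
    rw [dist_eq_norm, dist_zero_right] at h1
    have h2 := hB t ht
    have h3 := norm_sub_norm_le (f t x) (f t 0)
    linarith
  have hL0 : 0 ≤ K * R + B := by positivity
  -- The truncated field is bounded by `K R + B` everywhere, so in time `T` a curve moves at most
  -- `(K R + B) T`. With this radius the local theorem covers all of `[0, T]`.
  have hPL : IsPicardLindelof (fun t x => f t (radialRetraction R x))
      (⟨0, le_rfl, hT⟩ : Icc (0 : ℝ) T) x₀ (⟨(K * R + B) * T, by positivity⟩ : ℝ≥0) 0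
      (⟨K * R + B, hL0⟩ : ℝ≥0) (K * 2) := by
    refine ⟨fun t ht => ?_, fun x _ => hc _, fun t ht x _ => ?_, ?_⟩
    · have h2 : LipschitzWith 2 (radialRetraction R : E → E) :=
        LipschitzWith.of_dist_le_mul fun x y => by
          simpa [dist_eq_norm] using norm_radialRetraction_sub_le hR x y
      exact ((hf t ht).comp h2).lipschitzOnWith
    · refine (hlin t ht _).trans ?_
      change _ ≤ K * R + B
      gcongr
      exact (norm_radialRetraction_le hR x).1
    · change (K * R + B) * max (T - 0) (0 - 0) ≤ (K * R + B) * T - 0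
      simp [max_eq_left hT]
  obtain ⟨α, hα0, hα⟩ := hPL.exists_eq_forall_mem_Icc_hasDerivWithinAt₀
  have hα0' : α 0 = x₀ := hα0
  -- The retraction does not increase norms, so the truncated solution obeys the same growth bound.
  -- It stays in the ball of radius `R`, where truncation changes nothing.
  have hb := norm_le_gronwallBound_Icc (K := K) (ε := B) (δ := ‖x₀‖) hα (by rw [hα0'])
    (fun t ht => (hlin t ht _).trans (by gcongr; exact (norm_radialRetraction_le hR _).2))
  refine ⟨α, hα0', fun t ht => ?_⟩
  have hle : ‖α t‖ ≤ R := (hb t ht).trans (by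
    have := gronwallBound_mono (norm_nonneg x₀) hB0 (NNReal.coe_nonneg K) ht.2
    exact this.trans (by rw [hR_def]; exact le_add_of_nonneg_right zero_le_one))
  have := hα t ht
  rwa [radialRetraction_of_norm_le hR hle] at this

/-- A time-dependent vector field, differentiable in space, with a jointly continuous spatial
derivative `A` which is bounded on `[0, T]`. -/
structure IsC1Field (f : ℝ → E → E) (A : ℝ × E → E →L[ℝ] E) (T : ℝ) (K : ℝ≥0) : Prop where
  continuous_time : ∀ x, Continuous (f · x)
  hasFDerivAt : ∀ t x, HasFDerivAt (f t) (A (t, x)) x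
  continuous_fderiv : Continuous A
  bound : ∀ t ∈ Icc 0 T, ∀ x, ‖A (t, x)‖ ≤ K

namespace IsC1Field

variable {f : ℝ → E → E} {A : ℝ × E → E →L[ℝ] E} {T : ℝ} {K : ℝ≥0}

theorem lipschitz (h : IsC1Field f A T K) {t : ℝ} (ht : t ∈ Icc 0 T) : LipschitzWith K (f t) :=
  lipschitzWith_of_nnnorm_fderiv_le (𝕜 := ℝ) (fun x => (h.hasFDerivAt t x).differentiableAt)
    fun x => by rw [(h.hasFDerivAt t x).fderiv]; exact h.bound t ht x

theorem exists_flow [CompleteSpace E] (h : IsC1Field f A T K) (hT : 0 ≤ T) :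
    ∃ Φ : ℝ → E → E, (∀ x, Φ 0 x = x) ∧ ∀ x, IsIntegralCurveOn (Φ · x) f (Icc 0 T) := by
  choose α h0 h1 using exists_isIntegralCurveOn_of_lipschitz hT (fun t ht => h.lipschitz ht)
    (fun x => (h.continuous_time x).continuousOn)
  exact ⟨fun t x => α x t, h0, h1⟩

theorem reverse (h : IsC1Field f A T K) :
    IsC1Field (fun t x => -f (T - t) x) (fun q => -A (T - q.1, q.2)) T K where
  continuous_time x := ((h.continuous_time x).comp (by fun_prop : Continuous (T - ·))).neg
  hasFDerivAt t x := (h.hasFDerivAt (T - t) x).neg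
  continuous_fderiv := (h.continuous_fderiv.comp (by fun_prop)).neg
  bound t ht x := by
    rw [norm_neg]
    exact h.bound _ ⟨by linarith [ht.2], by linarith [ht.1]⟩ x

end IsC1Field

theorem hasDerivWithinAt_comp_sub_left {α : ℝ → E} {α' : E} {T t : ℝ}
    (h : HasDerivWithinAt α α' (Icc 0 T) (T - t)) :
    HasDerivWithinAt (fun s => α (T - s)) (-α') (Icc 0 T) t := by
  have := h.scomp t ((hasDerivAt_id t).const_sub T).hasDerivWithinAt (s := Icc 0 T)
    (fun s hs => ⟨by simpa using hs.2, by simpa using hs.1⟩)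
  rw [neg_one_smul] at this
  exact this

variable {f : ℝ → E → E} {T : ℝ} {K : ℝ≥0}

theorem dist_integralCurves_le (hf : ∀ t ∈ Icc 0 T, LipschitzWith K (f t)) {α β : ℝ → E}
    (hα : IsIntegralCurveOn α f (Icc 0 T)) (hβ : IsIntegralCurveOn β f (Icc 0 T)) :
    ∀ t ∈ Icc 0 T, ‖α t - β t‖ ≤ ‖α 0 - β 0‖ * Real.exp (K * t) := by
  intro t ht
  rw [← gronwallBound_ε0]
  refine norm_le_gronwallBound_Icc (f := fun t => α t - β t)
    (fun t ht => (hα t ht).sub (hβ t ht)) le_rfl (fun t ht => ?_) t ht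
  simpa [dist_eq_norm] using (hf t ht).dist_le_mul (α t) (β t)

theorem integralCurves_eq (hf : ∀ t ∈ Icc 0 T, LipschitzWith K (f t)) {α β : ℝ → E}
    (hα : IsIntegralCurveOn α f (Icc 0 T)) (hβ : IsIntegralCurveOn β f (Icc 0 T))
    (h0 : α 0 = β 0) : ∀ t ∈ Icc 0 T, α t = β t := by
  intro t ht
  have := dist_integralCurves_le hf hα hβ t ht
  rw [h0, sub_self, norm_zero, zero_mul] at this
  exact sub_eq_zero.1 (norm_le_zero_iff.1 this)

/-- The flow of a field over `[0, T]` is inverted by the flow of the time-reversed field. -/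
theorem reverse_flow_leftInverse (hT : 0 ≤ T) (hf : ∀ t ∈ Icc 0 T, LipschitzWith K (f t))
    {Φ Ψ : ℝ → E → E} (hΦ0 : ∀ x, Φ 0 x = x) (hΦ : ∀ x, IsIntegralCurveOn (Φ · x) f (Icc 0 T))
    (hΨ0 : ∀ x, Ψ 0 x = x)
    (hΨ : ∀ x, IsIntegralCurveOn (Ψ · x) (fun t x => -f (T - t) x) (Icc 0 T)) :
    Function.LeftInverse (Ψ T) (Φ T) ∧ Function.RightInverse (Ψ T) (Φ T) := by
  have hmem : ∀ t ∈ Icc 0 T, T - t ∈ Icc 0 T := fun t ht =>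
    ⟨by linarith [ht.2], by linarith [ht.1]⟩
  constructor
  · intro x
    have h1 : IsIntegralCurveOn (fun t => Ψ (T - t) (Φ T x)) f (Icc 0 T) := by
      intro t ht
      have := hasDerivWithinAt_comp_sub_left (hΨ (Φ T x) (T - t) (hmem t ht))
      simpa using this
    have hf' : ∀ t ∈ Icc 0 T, LipschitzWith K (fun x => -f (T - t) x) := fun t ht =>
      LipschitzWith.of_dist_le_mul fun x y => by
        rw [dist_neg_neg]; exact (hf _ (hmem t ht)).dist_le_mul x y
    -- The trajectory run backwards solves the reversed equation from `Φ T x`, hence agrees with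
    -- `Ψ`; at time `T` it is back at `x`.
    have h2 : IsIntegralCurveOn (fun t => Φ (T - t) x) (fun t x => -f (T - t) x) (Icc 0 T) :=
      fun t ht => hasDerivWithinAt_comp_sub_left (hΦ x (T - t) (hmem t ht))
    have := integralCurves_eq hf' (hΨ (Φ T x)) h2 (by simp [hΨ0]) T ⟨hT, le_rfl⟩
    simpa [hΦ0] using this
  · intro x
    have h1 : IsIntegralCurveOn (fun t => Ψ (T - t) x) f (Icc 0 T) := by
      intro t ht
      have := hasDerivWithinAt_comp_sub_left (hΨ x (T - t) (hmem t ht))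
      simpa using this
    have := integralCurves_eq hf (hΦ (Ψ T x)) h1 (by simp [hΦ0]) T ⟨hT, le_rfl⟩
    simpa [hΨ0] using this


variable {A : ℝ × E → E →L[ℝ] E}

/-- The spatial derivative of the field is continuous, uniformly along a compact trajectory. -/
theorem IsC1Field.exists_uniform_radius (h : IsC1Field f A T K) {γ : ℝ → E}
    (hγ : ContinuousOn γ (Icc 0 T)) {η : ℝ} (hη : 0 < η) :
    ∃ δ > 0, ∀ t ∈ Icc 0 T, ∀ z, ‖z - γ t‖ < δ → ‖A (t, z) - A (t, γ t)‖ ≤ η := by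
  have hcomp : IsCompact ((fun t => (t, γ t)) '' Icc 0 T) :=
    isCompact_Icc.image_of_continuousOn (continuousOn_id.prodMk hγ)
  have := hcomp.uniformContinuousAt_of_continuousAt A
    (fun a _ => h.continuous_fderiv.continuousAt) (Metric.dist_mem_uniformity hη)
  obtain ⟨δ, hδ, hsub⟩ := Metric.mem_uniformity_dist.1 this
  refine ⟨δ, hδ, fun t ht z hz => ?_⟩
  have hd : dist (t, γ t) (t, z) < δ := by
    rw [dist_comm, Prod.dist_eq, dist_self, dist_eq_norm]
    exact max_lt hδ hz
  have := hsub hd ⟨t, ht, rfl⟩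
  rw [← dist_eq_norm, dist_comm]
  exact le_of_lt this

/-- The flow of a `C¹` field is `C¹` in the initial value, and its derivative `J` solves the
variational equation. -/
theorem IsC1Field.exists_fderiv_flow [CompleteSpace E] (h : IsC1Field f A T K) (hT : 0 ≤ T)
    {Φ : ℝ → E → E} (hΦ0 : ∀ x, Φ 0 x = x) (hΦ : ∀ x, IsIntegralCurveOn (Φ · x) f (Icc 0 T)) :
    ∃ J : ℝ → E → E →L[ℝ] E, (∀ x, J 0 x = .id ℝ E) ∧
      (∀ x, IsIntegralCurveOn (J · x) (fun t X => (A (t, Φ t x)).comp X) (Icc 0 T)) ∧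
      ∀ t ∈ Icc 0 T, (∀ x, HasFDerivAt (Φ t) (J t x) x) ∧ Continuous (J t) := by
  have hcont : ∀ x, ContinuousOn (Φ · x) (Icc 0 T) := fun x => (hΦ x).continuousOn
  have hAlip : ∀ x, ∀ t ∈ Icc 0 T,
      LipschitzWith K (fun X : E →L[ℝ] E => (A (t, Φ t x)).comp X) := by
    intro x t ht
    refine LipschitzWith.of_dist_le_mul fun X Y => ?_
    rw [dist_eq_norm, dist_eq_norm, ← ContinuousLinearMap.comp_sub]
    exact (ContinuousLinearMap.opNorm_comp_le _ _).trans
      (mul_le_mul_of_nonneg_right (h.bound t ht _) (norm_nonneg _))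
  -- The variational equation is linear with coefficient bounded by `K`, so the same global
  -- existence theorem applies in the space of operators.
  have hex : ∀ x, ∃ J : ℝ → E →L[ℝ] E, J 0 = .id ℝ E ∧
      IsIntegralCurveOn J (fun t X => (A (t, Φ t x)).comp X) (Icc 0 T) := fun x =>
    exists_isIntegralCurveOn_of_lipschitz hT (hAlip x) (fun X =>
      (h.continuous_fderiv.comp_continuousOn (continuousOn_id.prodMk (hcont x))).clm_comp
        continuousOn_const) _
  choose J hJ0 hJ using hex
  have hlipf : ∀ t ∈ Icc 0 T, LipschitzWith K (f t) := fun t ht => h.lipschitz ht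
  set C : ℝ := Real.exp (K * T) with hC
  have hdist : ∀ x y, ∀ t ∈ Icc 0 T, ‖Φ t y - Φ t x‖ ≤ C * ‖y - x‖ := by
    intro x y t ht
    refine (dist_integralCurves_le hlipf (hΦ y) (hΦ x) t ht).trans ?_
    rw [hΦ0, hΦ0, mul_comm, hC]
    gcongr
    exact ht.2
  set g : ℝ := gronwallBound 0 K 1 T with hg
  have hg0 : 0 ≤ g := gronwallBound_nonneg le_rfl K.2 zero_le_one hT
  have hgr : ∀ ε' ≥ 0, ∀ t ∈ Icc 0 T, gronwallBound 0 K ε' t ≤ ε' * g := by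
    intro ε' hε' t ht
    rw [gronwallBound_zero_eq_mul]
    gcongr
    exact gronwallBound_mono le_rfl zero_le_one K.2 ht.2
  -- Uniform continuity of `A` along the trajectory of `x`. Initial values within `δ / C` stay
  -- within `δ` for all times, and the estimate holds on a whole ball so that the mean value
  -- inequality can be used there.
  have hfin : ∀ x, ∀ η > 0, ∃ δ > 0, ∀ y, ‖y - x‖ < δ → ∀ t ∈ Icc 0 T, ∀ z,
      ‖z - Φ t x‖ ≤ ‖Φ t y - Φ t x‖ → ‖A (t, z) - A (t, Φ t x)‖ ≤ η := by
    intro x η hη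
    obtain ⟨δ, hδ, H⟩ := h.exists_uniform_radius (hcont x) hη
    refine ⟨δ / C, by positivity, fun y hy t ht z hz => H t ht z (hz.trans_lt ?_)⟩
    refine (hdist x y t ht).trans_lt ?_
    rwa [mul_comm, ← lt_div_iff₀ (by positivity)]
  refine ⟨fun t x => J x t, hJ0, hJ, fun t ht => ⟨fun x => ?_, ?_⟩⟩
  · rw [hasFDerivAt_iff_isLittleO, Asymptotics.isLittleO_iff]
    intro c hc
    -- With forcing `η C ‖y - x‖`, Grönwall bounds the remainder by `η C g ‖y - x‖`, so this `η`
    -- gives at most `c ‖y - x‖`; the 1 avoids division by zero.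
    obtain ⟨δ, hδ, H⟩ := hfin x (c / (C * g + 1)) (by positivity)
    filter_upwards [Metric.ball_mem_nhds x hδ] with y hy
    rw [Metric.mem_ball, dist_eq_norm] at hy
    have hw : ∀ t ∈ Icc 0 T, HasDerivWithinAt (fun t => Φ t y - Φ t x - J x t (y - x))
        (f t (Φ t y) - f t (Φ t x) - A (t, Φ t x) (J x t (y - x))) (Icc 0 T) t := by
      intro t ht
      exact ((hΦ y t ht).sub (hΦ x t ht)).sub ((hJ x t ht).clm_apply
        (hasDerivWithinAt_const t _ (y - x)) |>.congr_deriv (by simp))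
    have := norm_le_gronwallBound_Icc (δ := 0) (K := K)
      (ε := c / (C * g + 1) * (C * ‖y - x‖)) hw (by simp [hΦ0, hJ0]) ?_ t ht
    · refine this.trans ((hgr _ (by positivity) t ht).trans ?_)
      have : c / (C * g + 1) * (C * ‖y - x‖) * g = c * ‖y - x‖ * ((C * g) / (C * g + 1)) := by
        ring
      rw [this]
      refine mul_le_of_le_one_right (by positivity) ((div_le_one (by positivity)).2 ?_)
      linarith
    · intro t ht
      have hmv := (convex_closedBall (Φ t x)
        ‖Φ t y - Φ t x‖).norm_image_sub_le_of_norm_hasFDerivWithin_le'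
        (f := f t) (φ := A (t, Φ t x)) (C := c / (C * g + 1))
        (fun z _ => (h.hasFDerivAt t z).hasFDerivWithinAt)
        (fun z hz => H y hy t ht z (by simpa [dist_eq_norm] using hz))
        (Metric.mem_closedBall_self (norm_nonneg _))
        (y := Φ t y) (by simp [dist_eq_norm])
      -- The first part is `A` applied to the remainder, the Grönwall term; the second is the
      -- linearisation error of `f`, controlled by the mean value inequality.
      have hsplit : f t (Φ t y) - f t (Φ t x) - A (t, Φ t x) (J x t (y - x)) =
          A (t, Φ t x) (Φ t y - Φ t x - J x t (y - x)) +
            (f t (Φ t y) - f t (Φ t x) - A (t, Φ t x) (Φ t y - Φ t x)) := by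
        simp only [map_sub]; abel
      rw [hsplit]
      refine (norm_add_le _ _).trans (add_le_add ?_ (hmv.trans ?_))
      · exact (A (t, Φ t x)).le_of_opNorm_le (h.bound t ht _) _
      · gcongr
        exact hdist x y t ht
  · rw [continuous_iff_continuousAt]
    intro x
    obtain ⟨D, hD⟩ := isCompact_Icc.exists_bound_of_continuousOn (hJ x).continuousOn
    have hD0 : 0 ≤ D := (norm_nonneg _).trans (hD t ht)
    rw [Metric.continuousAt_iff]
    intro c hc
    obtain ⟨δ, hδ, H⟩ := hfin x (c / 2 / (D * g + 1)) (by positivity)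
    refine ⟨δ, hδ, fun {y} hy => ?_⟩
    rw [dist_eq_norm] at hy ⊢
    have := norm_le_gronwallBound_Icc (δ := 0) (K := K)
      (ε := c / 2 / (D * g + 1) * D) (f := fun t => J y t - J x t)
      (fun t ht => (hJ y t ht).sub (hJ x t ht)) (by simp [hJ0]) ?_ t ht
    · refine (this.trans (hgr _ (by positivity) t ht)).trans_lt ?_
      have : c / 2 / (D * g + 1) * D * g = c / 2 * ((D * g) / (D * g + 1)) := by ring
      rw [this]
      refine (mul_le_of_le_one_right (by positivity)
        ((div_le_one (by positivity)).2 ?_)).trans_lt (half_lt_self hc)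
      linarith
    · intro t ht
      -- Arranged so that the forcing contains only `J x`, bounded by `D`; no bound on `J y` is
      -- required.
      have hsplit : (A (t, Φ t y)).comp (J y t) - (A (t, Φ t x)).comp (J x t) =
          (A (t, Φ t y)).comp (J y t - J x t) + (A (t, Φ t y) - A (t, Φ t x)).comp (J x t) := by
        rw [ContinuousLinearMap.comp_sub, ContinuousLinearMap.sub_comp]; abel
      rw [hsplit]
      refine (norm_add_le _ _).trans (add_le_add ?_ ?_)
      · exact (ContinuousLinearMap.opNorm_comp_le _ _).trans
          (mul_le_mul_of_nonneg_right (h.bound t ht _) (norm_nonneg _))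
      · refine (ContinuousLinearMap.opNorm_comp_le _ _).trans ?_
        exact mul_le_mul (H y hy t ht _ le_rfl) (hD t ht) (norm_nonneg _) (by positivity)

end Ode

/-! ### Determinants along linear equations and transport of densities. -/

section Liouville

/-- Jacobi's formula for the derivative of the determinant. -/
theorem hasDerivWithinAt_matrix_det {ι : Type*} [Fintype ι] [DecidableEq ι]
    {M : ℝ → Matrix ι ι ℝ} {M' : Matrix ι ι ℝ} {s : Set ℝ} {t : ℝ}
    (h : ∀ i j, HasDerivWithinAt (fun t => M t i j) (M' i j) s t) :
    HasDerivWithinAt (fun t => (M t).det) (M' * (M t).adjugate).trace s t := by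
  let D : ContinuousMultilinearMap ℝ (fun _ : ι => ι → ℝ) ℝ :=
    { toMultilinearMap := Matrix.detRowAlternating.toMultilinearMap
      cont := Continuous.matrix_det (A := fun M : Matrix ι ι ℝ => M) continuous_id }
  have hM : HasDerivWithinAt (fun t => (fun i j => M t i j : ι → ι → ℝ)) (fun i j => M' i j) s t :=
    hasDerivWithinAt_pi.2 fun i => hasDerivWithinAt_pi.2 fun j => h i j
  have hD := (D.hasFDerivAt (fun i j => M t i j)).comp_hasDerivWithinAt t hM
  refine hD.congr_deriv ?_
  rw [ContinuousMultilinearMap.linearDeriv_apply, Matrix.trace]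
  refine Finset.sum_congr rfl fun i _ => ?_
  -- The `i`-th term of the multilinear derivative replaces row `i` of `M` by that of `M'`; Cramer's
  -- rule makes it a diagonal entry of `M' * adjugate M`.
  change ((M t).updateRow i (M' i)).det = _
  rw [← Matrix.cramer_transpose_apply, Matrix.cramer_eq_adjugate_mulVec, ← Matrix.adjugate_transpose,
    Matrix.mulVec_transpose, Matrix.diag_apply, Matrix.mul_apply_eq_vecMul]

variable {E : Type*} [NormedAddCommGroup E] [NormedSpace ℝ E] [FiniteDimensional ℝ E]

/-- Liouville's formula: along `J' = A J` the determinant satisfies `(det J)' = tr A det J`. -/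
theorem hasDerivWithinAt_det_of_linear {J : ℝ → E →L[ℝ] E} {A : E →L[ℝ] E} {s : Set ℝ} {t : ℝ}
    (h : HasDerivWithinAt J (A.comp (J t)) s t) :
    HasDerivWithinAt (fun t => (J t).det) (LinearMap.trace ℝ E A * (J t).det) s t := by
  let b := Module.finBasis ℝ E
  have hdet : ∀ B : E →L[ℝ] E, B.det = (LinearMap.toMatrix b b B).det := fun B =>
    (LinearMap.det_toMatrix b (B : E →ₗ[ℝ] E)).symm
  simp_rw [hdet]
  have hentry : ∀ i j, HasDerivWithinAt (fun t => LinearMap.toMatrix b b (J t : E →ₗ[ℝ] E) i j)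
      (LinearMap.toMatrix b b (A.comp (J t) : E →ₗ[ℝ] E) i j) s t := by
    intro i j
    simp only [LinearMap.toMatrix_apply]
    have h1 := h.clm_apply (hasDerivWithinAt_const t s (b j))
    have h2 := (LinearMap.toContinuousLinearMap (b.coord i)).hasFDerivAt.comp_hasDerivWithinAt t h1
    exact h2.congr_deriv (by simp)
  refine (hasDerivWithinAt_matrix_det hentry).congr_deriv ?_
  rw [ContinuousLinearMap.toLinearMap_comp, LinearMap.toMatrix_comp b b b, Matrix.mul_assoc,
    Matrix.mul_adjugate, Matrix.mul_smul, mul_one, Matrix.trace_smul,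
    LinearMap.trace_eq_matrix_trace ℝ b, smul_eq_mul, mul_comm]

/-- If a density `ρ` solves the continuity equation of a field `f`, then `ρ` times the Jacobian
determinant is constant along the flow of `f`. -/
theorem continuity_equation_along_flow {f : ℝ → E → E} {A : ℝ × E → E →L[ℝ] E} {T : ℝ}
    {γ : ℝ → E} {J : ℝ → E →L[ℝ] E} {ρ : ℝ × E → ℝ}
    (hγ : IsIntegralCurveOn γ f (Icc 0 T))
    (hJ : IsIntegralCurveOn J (fun t X => (A (t, γ t)).comp X) (Icc 0 T))
    (hρ : Differentiable ℝ ρ)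
    (hce : ∀ t x, fderiv ℝ ρ (t, x) (1, f t x) + ρ (t, x) * LinearMap.trace ℝ E (A (t, x)) = 0) :
    ∀ t ∈ Icc 0 T, ρ (t, γ t) * (J t).det = ρ (0, γ 0) * (J 0).det := by
  have hd : ∀ t ∈ Icc 0 T, HasDerivWithinAt (fun t => ρ (t, γ t) * (J t).det) 0 (Icc 0 T) t := by
    intro t ht
    have h1 : HasDerivWithinAt (fun t => (t, γ t)) (1, f t (γ t)) (Icc 0 T) t :=
      (hasDerivWithinAt_id t _).prodMk (hγ t ht)
    have h2 := (hρ (t, γ t)).hasFDerivAt.comp_hasDerivWithinAt t h1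
    refine (h2.mul (hasDerivWithinAt_det_of_linear (hJ t ht))).congr_deriv ?_
    have := hce t (γ t)
    rw [← mul_assoc, ← add_mul]
    simp [this]
  exact constant_of_has_deriv_right_zero (fun t ht => (hd t ht).continuousWithinAt)
    (fun t ht => (hd t (Ico_subset_Icc_self ht)).mono_of_mem_nhdsWithin (Icc_mem_nhdsGE_of_mem ht))

end Liouville

/-! ### Exponential tilts of a boundedly supported measure: mass, mean, covariance. -/

section ExponentialFamily

variable {E : Type*} [NormedAddCommGroup E] [InnerProductSpace ℝ E]
  {F : Type*} [NormedAddCommGroup F] [NormedSpace ℝ F]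

/-- The weight `exp (l ⟪z, y⟫ - l² ‖y‖² / 2)` at `q = (l, z)`. -/
noncomputable def tiltWeight (q : ℝ × E) (y : E) : ℝ :=
  Real.exp (q.1 * inner ℝ q.2 y - q.1 ^ 2 / 2 * ‖y‖ ^ 2)

/-- The derivative of the logarithm of `tiltWeight q y` with respect to `q`. -/
noncomputable def tiltForm (q : ℝ × E) (y : E) : ℝ × E →L[ℝ] ℝ :=
  (inner ℝ q.2 y - q.1 * ‖y‖ ^ 2) • ContinuousLinearMap.fst ℝ ℝ E +
    q.1 • (innerSL ℝ y).comp (ContinuousLinearMap.snd ℝ ℝ E)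

/-- The integral of `f` against `μ`, tilted by `tiltWeight q`. -/
noncomputable def tiltIntegral [MeasurableSpace E] (μ : Measure E) (f : E → F) (q : ℝ × E) : F :=
  ∫ y, tiltWeight q y • f y ∂μ

theorem tiltWeight_pos (q : ℝ × E) (y : E) : 0 < tiltWeight q y := Real.exp_pos _

theorem continuous_tiltWeight : Continuous fun r : (ℝ × E) × E => tiltWeight r.1 r.2 := by
  unfold tiltWeight; fun_prop

theorem continuous_tiltForm : Continuous fun r : (ℝ × E) × E => tiltForm r.1 r.2 := by
  unfold tiltForm; fun_prop

theorem hasFDerivAt_tiltWeight (q : ℝ × E) (y : E) :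
    HasFDerivAt (fun q => tiltWeight q y) (tiltWeight q y • tiltForm q y) q := by
  have h1 : HasFDerivAt (fun q : ℝ × E => q.1 * inner ℝ q.2 y - q.1 ^ 2 / 2 * ‖y‖ ^ 2)
      (tiltForm q y) q := by
    have hf : HasFDerivAt (fun q : ℝ × E => q.1) (ContinuousLinearMap.fst ℝ ℝ E) q :=
      hasFDerivAt_fst
    have hs : HasFDerivAt (fun q : ℝ × E => inner ℝ q.2 y)
        ((innerSL ℝ y).comp (ContinuousLinearMap.snd ℝ ℝ E)) q := by
      have := (innerSL ℝ y).hasFDerivAt.comp q (hasFDerivAt_snd (𝕜 := ℝ) (p := q))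
      refine this.congr_of_eventuallyEq (Filter.Eventually.of_forall fun r => ?_)
      simp [real_inner_comm]
    simp only [div_eq_mul_inv]
    refine ((hf.mul hs).sub (((hf.pow 2).mul_const (2⁻¹ : ℝ)).mul_const (‖y‖ ^ 2))).congr_fderiv ?_
    ext
    · simp [tiltForm]; ring
    · simp [tiltForm]
  exact h1.exp

theorem continuous_smulRight_self : Continuous fun y : E => (innerSL ℝ y).smulRight y :=
  ((ContinuousLinearMap.smulRightL ℝ E E).continuous.comp (innerSL ℝ).continuous).clm_apply
    continuous_id

variable [FiniteDimensional ℝ E] [MeasurableSpace E] [BorelSpace E]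
  {μ : Measure E} [IsFiniteMeasure μ] {R : ℝ}

omit [NormedSpace ℝ F] in
theorem integrable_of_continuous_of_bounded_support (hR : ∀ᵐ y ∂μ, ‖y‖ ≤ R)
    {g : E → F} (hg : Continuous g) : Integrable g μ := by
  have : ProperSpace E := FiniteDimensional.proper ℝ E
  obtain ⟨C, hC⟩ := (isCompact_closedBall (0 : E) R).exists_bound_of_continuousOn hg.continuousOn
  exact Integrable.of_bound hg.aestronglyMeasurable C
    (hR.mono fun y hy => hC y (by simpa using hy))

theorem integrable_tilt (hR : ∀ᵐ y ∂μ, ‖y‖ ≤ R) {f : E → F} (hf : Continuous f) (q : ℝ × E) :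
    Integrable (fun y => tiltWeight q y • f y) μ :=
  integrable_of_continuous_of_bounded_support hR
    ((continuous_tiltWeight.comp (by fun_prop : Continuous fun y : E => (q, y))).smul hf)

/-- The differentiated integrand is jointly continuous, hence bounded on a unit ball around `q`
times the ball of radius `R` carrying `μ`. A constant therefore dominates. -/
theorem hasFDerivAt_tiltIntegral (hR : ∀ᵐ y ∂μ, ‖y‖ ≤ R) {f : E → F}
    (hf : Continuous f) (q : ℝ × E) :
    HasFDerivAt (tiltIntegral μ f) (tiltIntegral μ (fun y => (tiltForm q y).smulRight (f y)) q)
      q := by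
  have : ProperSpace E := FiniteDimensional.proper ℝ E
  have hc : Continuous fun r : (ℝ × E) × E =>
      tiltWeight r.1 r.2 • (tiltForm r.1 r.2).smulRight (f r.2) :=
    continuous_tiltWeight.smul
      (((ContinuousLinearMap.smulRightL ℝ (ℝ × E) F).continuous.comp continuous_tiltForm).clm_apply
        (hf.comp continuous_snd))
  obtain ⟨C, hC⟩ := ((isCompact_closedBall q 1).prod
    (isCompact_closedBall (0 : E) R)).exists_bound_of_continuousOn
    (f := fun r : (ℝ × E) × E => tiltWeight r.1 r.2 • (tiltForm r.1 r.2).smulRight (f r.2))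
    hc.continuousOn
  refine hasFDerivAt_integral_of_dominated_of_fderiv_le (bound := fun _ => C)
    (F' := fun q y => tiltWeight q y • (tiltForm q y).smulRight (f y))
    (Metric.ball_mem_nhds q one_pos) (Filter.Eventually.of_forall fun q' =>
      (integrable_tilt hR hf q').aestronglyMeasurable) (integrable_tilt hR hf q) ?_ ?_
    (integrable_const C) (Filter.Eventually.of_forall fun y q' _ => ?_)
  · have hq : Continuous fun y => (tiltForm q y).smulRight (f y) :=
      ((ContinuousLinearMap.smulRightL ℝ (ℝ × E) F).continuous.comp
        (continuous_tiltForm.comp (by fun_prop : Continuous fun y : E => (q, y)))).clm_apply hf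
    exact (integrable_tilt hR hq q).aestronglyMeasurable
  · filter_upwards [hR] with y hy q' hq'
    exact hC (q', y) ⟨Metric.ball_subset_closedBall hq', by simpa using hy⟩
  · refine ((hasFDerivAt_tiltWeight q' y).smul_const (f y)).congr_fderiv ?_
    ext <;> simp [smul_smul]

theorem continuous_tiltIntegral (hR : ∀ᵐ y ∂μ, ‖y‖ ≤ R) {f : E → F} (hf : Continuous f) :
    Continuous (tiltIntegral μ f) :=
  continuous_iff_continuousAt.2 fun q => (hasFDerivAt_tiltIntegral hR hf q).continuousAt

/-- The tilted mass of `μ`. -/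
noncomputable def tiltMass (μ : Measure E) : ℝ × E → ℝ := tiltIntegral μ fun _ => (1 : ℝ)

/-- The mean of the tilted measure, normalised. -/
noncomputable def tiltMean (μ : Measure E) (q : ℝ × E) : E :=
  (tiltMass μ q)⁻¹ • tiltIntegral μ (fun y => y) q

/-- The covariance operator of the tilted measure, normalised. -/
noncomputable def tiltCov (μ : Measure E) (q : ℝ × E) : E →L[ℝ] E :=
  (tiltMass μ q)⁻¹ • tiltIntegral μ (fun y => (innerSL ℝ y).smulRight y) q -
    (innerSL ℝ (tiltMean μ q)).smulRight (tiltMean μ q)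

theorem norm_tiltIntegral_le (hR : ∀ᵐ y ∂μ, ‖y‖ ≤ R) {f : E → F} {C : ℝ}
    (hC : ∀ᵐ y ∂μ, ‖f y‖ ≤ C) (q : ℝ × E) : ‖tiltIntegral μ f q‖ ≤ C * tiltMass μ q := by
  rw [tiltMass, tiltIntegral, tiltIntegral, ← integral_const_mul]
  refine norm_integral_le_of_norm_le ((integrable_tilt hR continuous_const q).const_mul C)
    (hC.mono fun y hy => ?_)
  rw [norm_smul, Real.norm_of_nonneg (tiltWeight_pos q y).le, smul_eq_mul, mul_one, mul_comm]
  exact mul_le_mul_of_nonneg_right hy (tiltWeight_pos q y).le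

theorem tiltMass_pos [NeZero μ] (hR : ∀ᵐ y ∂μ, ‖y‖ ≤ R) (q : ℝ × E) : 0 < tiltMass μ q := by
  rw [tiltMass, tiltIntegral, integral_pos_iff_support_of_nonneg
    (fun y => by simpa using (tiltWeight_pos q y).le) (integrable_tilt hR continuous_const q)]
  have : Function.support (fun y => tiltWeight q y • (1 : ℝ)) = univ := by
    ext y; simpa using (tiltWeight_pos q y).ne'
  rw [this]
  exact (NeZero.pos (μ univ))

theorem continuous_tiltMean [NeZero μ] (hR : ∀ᵐ y ∂μ, ‖y‖ ≤ R) : Continuous (tiltMean μ) :=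
  ((continuous_tiltIntegral hR continuous_const).inv₀ fun q => (tiltMass_pos hR q).ne').smul
    (continuous_tiltIntegral hR continuous_id)

theorem continuous_tiltCov [NeZero μ] (hR : ∀ᵐ y ∂μ, ‖y‖ ≤ R) : Continuous (tiltCov μ) :=
  (((continuous_tiltIntegral hR continuous_const).inv₀ fun q => (tiltMass_pos hR q).ne').smul
    (continuous_tiltIntegral hR continuous_smulRight_self)).sub
    (continuous_smulRight_self.comp (continuous_tiltMean hR))

theorem norm_inv_tiltMass_smul_le [NeZero μ] (hR : ∀ᵐ y ∂μ, ‖y‖ ≤ R) {f : E → F} {C : ℝ}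
    (hC : ∀ᵐ y ∂μ, ‖f y‖ ≤ C) (q : ℝ × E) : ‖(tiltMass μ q)⁻¹ • tiltIntegral μ f q‖ ≤ C := by
  have h0 := tiltMass_pos hR q
  rw [norm_smul, norm_inv, Real.norm_of_nonneg h0.le, inv_mul_le_iff₀ h0, mul_comm]
  exact norm_tiltIntegral_le hR hC q

theorem norm_tiltMean_le [NeZero μ] (hR : ∀ᵐ y ∂μ, ‖y‖ ≤ R) (q : ℝ × E) : ‖tiltMean μ q‖ ≤ R :=
  norm_inv_tiltMass_smul_le hR hR q

/-- The second moment and the square of the mean each contribute at most `R ^ 2`. The bound is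
uniform in `q`, which is the source of every Lipschitz constant below. -/
theorem norm_tiltCov_le [NeZero μ] (hR : ∀ᵐ y ∂μ, ‖y‖ ≤ R) (q : ℝ × E) :
    ‖tiltCov μ q‖ ≤ 2 * R ^ 2 := by
  have hn : ∀ y : E, ‖y‖ ≤ R → ‖(innerSL ℝ y).smulRight y‖ ≤ R ^ 2 := fun y hy => by
    rw [ContinuousLinearMap.norm_smulRight_apply, innerSL_apply_norm, sq]
    gcongr
    exact (norm_nonneg _).trans hy
  refine (norm_sub_le _ _).trans ?_
  have h1 := norm_inv_tiltMass_smul_le hR (f := fun y => (innerSL ℝ y).smulRight y)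
    (hR.mono hn) q
  have h2 := hn _ (norm_tiltMean_le hR q)
  linarith

/-- The spatial derivative of a tilted integral. -/
theorem hasFDerivAt_tiltIntegral_right (hR : ∀ᵐ y ∂μ, ‖y‖ ≤ R) {f : E → F} (hf : Continuous f)
    (l : ℝ) (z : E) :
    HasFDerivAt (fun z => tiltIntegral μ f (l, z))
      (l • tiltIntegral μ (fun y => (innerSL ℝ y).smulRight (f y)) (l, z)) z := by
  have h1 : HasFDerivAt (fun z : E => (l, z)) (ContinuousLinearMap.inr ℝ ℝ E) z :=
    hasFDerivAt_prodMk_right l z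
  refine ((hasFDerivAt_tiltIntegral hR hf (l, z)).comp z h1).congr_fderiv ?_
  have hc : Continuous fun y => (tiltForm (l, z) y).smulRight (f y) :=
    ((ContinuousLinearMap.smulRightL ℝ (ℝ × E) F).continuous.comp
      (continuous_tiltForm.comp (by fun_prop : Continuous fun y : E => ((l, z), y)))).clm_apply hf
  have hc' : Continuous fun y => (innerSL ℝ y).smulRight (f y) :=
    ((ContinuousLinearMap.smulRightL ℝ E F).continuous.comp (innerSL ℝ).continuous).clm_apply hf
  ext h
  rw [ContinuousLinearMap.comp_apply, smul_apply, tiltIntegral, tiltIntegral,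
    ContinuousLinearMap.integral_apply (integrable_tilt hR hc _),
    ContinuousLinearMap.integral_apply (integrable_tilt hR hc' _), ← integral_smul]
  refine integral_congr_ae (Filter.Eventually.of_forall fun y => ?_)
  simp [tiltForm, smul_smul]
  congr 1; ring

theorem hasFDerivAt_tiltMass_right (hR : ∀ᵐ y ∂μ, ‖y‖ ≤ R) (l : ℝ) (z : E) :
    HasFDerivAt (fun z => tiltMass μ (l, z))
      (l • innerSL ℝ (tiltIntegral μ (fun y => y) (l, z))) z := by
  refine (hasFDerivAt_tiltIntegral_right hR continuous_const l z).congr_fderiv ?_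
  congr 1
  have h := (innerSL ℝ (E := E)).integral_comp_comm (integrable_tilt hR continuous_id (l, z))
  rw [tiltIntegral, tiltIntegral]
  refine Eq.trans ?_ h
  refine integral_congr_ae (Filter.Eventually.of_forall fun y => ?_)
  ext; simp
  exact Or.inl rfl

/-- The exponential-family identity: differentiating the mean in the natural parameter gives the
covariance, by the quotient rule. -/
theorem hasFDerivAt_tiltMean_right [NeZero μ] (hR : ∀ᵐ y ∂μ, ‖y‖ ≤ R) (l : ℝ) (z : E) :
    HasFDerivAt (fun z => tiltMean μ (l, z)) (l • tiltCov μ (l, z)) z := by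
  have h0 := (tiltMass_pos hR (l, z)).ne'
  have h1 := (hasDerivAt_inv h0).comp_hasFDerivAt z (hasFDerivAt_tiltMass_right hR l z)
  refine (h1.smul (hasFDerivAt_tiltIntegral_right hR continuous_id l z)).congr_fderiv ?_
  ext h
  simp only [tiltCov, tiltMean, id, Function.comp_apply]
  simp [smul_sub, smul_smul]
  rw [sub_eq_add_neg, mul_comm l]
  congr 3
  ring

/-- The second moment of the tilted measure, not normalised. -/
noncomputable def tiltSq (μ : Measure E) : ℝ × E → ℝ := tiltIntegral μ fun y => ‖y‖ ^ 2

/-- The trace is linear, so it passes through the integral, and `y ⊗ y` has trace `‖y‖ ^ 2`. Up to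
the factor `l`, this is the divergence of the mean field. -/
theorem trace_tiltCov (hR : ∀ᵐ y ∂μ, ‖y‖ ≤ R) (q : ℝ × E) :
    LinearMap.trace ℝ E (tiltCov μ q) = (tiltMass μ q)⁻¹ * tiltSq μ q - ‖tiltMean μ q‖ ^ 2 := by
  let tr : (E →L[ℝ] E) →L[ℝ] ℝ := LinearMap.toContinuousLinearMap
    ((LinearMap.trace ℝ E).comp (ContinuousLinearMap.coeLM ℝ))
  have htr : ∀ B : E →L[ℝ] E, tr B = LinearMap.trace ℝ E B := fun B => rfl
  have hone : ∀ y : E, tr ((innerSL ℝ y).smulRight y) = ‖y‖ ^ 2 := by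
    intro y
    rw [htr]
    refine (LinearMap.trace_smulRight (innerSL ℝ y : E →ₗ[ℝ] ℝ) y).trans ?_
    exact real_inner_self_eq_norm_sq y
  have hint : tr (tiltIntegral μ (fun y => (innerSL ℝ y).smulRight y) q) = tiltSq μ q := by
    have h := tr.integral_comp_comm (integrable_tilt hR continuous_smulRight_self q)
    rw [tiltIntegral, ← h, tiltSq, tiltIntegral]
    exact integral_congr_ae (Filter.Eventually.of_forall fun y => by simp [hone])
  rw [← htr, tiltCov, map_sub, map_smul, hint, hone, smul_eq_mul]

/-- The direction `(1, v)` is that of a curve whose parameter `l` moves at unit speed while `z`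
moves with velocity `v`. -/
theorem hasFDerivAt_tiltMass (hR : ∀ᵐ y ∂μ, ‖y‖ ≤ R) (q : ℝ × E) :
    ∃ D : ℝ × E →L[ℝ] ℝ, HasFDerivAt (tiltMass μ) D q ∧ ∀ v : E,
      D (1, v) = inner ℝ q.2 (tiltIntegral μ (fun y => y) q) - q.1 * tiltSq μ q +
        q.1 * inner ℝ v (tiltIntegral μ (fun y => y) q) := by
  refine ⟨_, hasFDerivAt_tiltIntegral hR continuous_const q, fun v => ?_⟩
  have hc : Continuous fun y => (tiltForm q y).smulRight (1 : ℝ) :=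
    ((ContinuousLinearMap.smulRightL ℝ (ℝ × E) ℝ).continuous.comp
      (continuous_tiltForm.comp (by fun_prop : Continuous fun y : E => (q, y)))).clm_apply
      continuous_const
  have hid := integrable_tilt hR continuous_id q
  have hsq := integrable_tilt hR (f := fun y => ‖y‖ ^ 2) (by fun_prop) q
  have hin : ∀ w : E, ∫ y, tiltWeight q y * inner ℝ w y ∂μ =
      inner ℝ w (tiltIntegral μ (fun y => y) q) := by
    intro w
    have h := (innerSL ℝ w).integral_comp_comm hid
    refine Eq.trans ?_ h
    refine integral_congr_ae (Filter.Eventually.of_forall fun y => ?_)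
    simp
  have hii : ∀ w : E, Integrable (fun y => tiltWeight q y * inner ℝ w y) μ := fun w =>
    integrable_tilt hR (f := fun y => inner ℝ w y) (by fun_prop) q
  have hsq' : Integrable (fun y => q.1 * (tiltWeight q y * ‖y‖ ^ 2)) μ := hsq.const_mul _
  rw [tiltIntegral, ContinuousLinearMap.integral_apply (integrable_tilt hR hc _), ← hin, ← hin,
    tiltSq, tiltIntegral]
  simp only [smul_eq_mul]
  rw [← integral_const_mul, ← integral_const_mul, ← integral_sub (hii _) hsq',
    ← integral_add (f := fun y => tiltWeight q y * inner ℝ q.2 y - q.1 * (tiltWeight q y * ‖y‖ ^ 2))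
      ((hii q.2).sub hsq') ((hii v).const_mul _)]
  refine integral_congr_ae (Filter.Eventually.of_forall fun y => ?_)
  simp [tiltForm, real_inner_comm]
  ring

/-- The unnormalised density `z ↦ ∫ exp (-‖z - l y‖² / 2) dμ(y)` at `q = (l, z)`. -/
noncomputable def tiltDensity (μ : Measure E) (q : ℝ × E) : ℝ :=
  Real.exp (-‖q.2‖ ^ 2 / 2) * tiltMass μ q

theorem tiltDensity_pos [NeZero μ] (hR : ∀ᵐ y ∂μ, ‖y‖ ≤ R) (q : ℝ × E) : 0 < tiltDensity μ q :=
  mul_pos (Real.exp_pos _) (tiltMass_pos hR q)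

/-- The density `tiltDensity μ (l, ·)` is transported by the field `tiltMean μ (l, ·)`. -/
theorem tiltDensity_continuity_equation [NeZero μ] (hR : ∀ᵐ y ∂μ, ‖y‖ ≤ R) (q : ℝ × E) :
    ∃ D : ℝ × E →L[ℝ] ℝ, HasFDerivAt (tiltDensity μ) D q ∧
      D (1, tiltMean μ q) +
        tiltDensity μ q * LinearMap.trace ℝ E (q.1 • tiltCov μ q : E →L[ℝ] E) = 0 := by
  obtain ⟨D, hD, hDv⟩ := hasFDerivAt_tiltMass hR q
  have hsq : HasFDerivAt (fun q : ℝ × E => ‖q.2‖ ^ 2)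
      ((2 • innerSL ℝ q.2).comp (ContinuousLinearMap.snd ℝ ℝ E)) q :=
    (hasStrictFDerivAt_norm_sq q.2).hasFDerivAt.comp q hasFDerivAt_snd
  have hexp := (hsq.neg.mul_const (2⁻¹ : ℝ)).exp
  refine ⟨_, hexp.mul hD, ?_⟩
  have h0 := (tiltMass_pos hR q).ne'
  have hM : tiltIntegral μ (fun y => y) q = tiltMass μ q • tiltMean μ q := by
    rw [tiltMean, smul_inv_smul₀ h0]
  have htr : LinearMap.trace ℝ E (q.1 • tiltCov μ q : E →L[ℝ] E) =
      q.1 * ((tiltMass μ q)⁻¹ * tiltSq μ q - ‖tiltMean μ q‖ ^ 2) := by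
    rw [← trace_tiltCov hR]
    simp
  rw [htr]
  -- The Gaussian factor contributes `-⟪z, m⟫`, which cancels the `⟪z, m⟫` from the mass; what is
  -- left is `l (‖m‖² - tiltSq / tiltMass)`, minus the trace.
  simp only [add_apply, smul_apply, neg_apply, hDv, hM, inner_smul_right, real_inner_self_eq_norm_sq,
    ContinuousLinearMap.comp_apply, ContinuousLinearMap.coe_snd', smul_eq_mul, innerSL_apply_apply,
    tiltDensity, div_eq_mul_inv, nsmul_eq_mul, Pi.neg_apply]
  push_cast
  field_simp
  ring

end ExponentialFamily

/-! ### The flow of the tilted mean. -/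

section TiltFlow

variable {E : Type*} [NormedAddCommGroup E] [InnerProductSpace ℝ E] [FiniteDimensional ℝ E]
  [MeasurableSpace E] [BorelSpace E] {μ : Measure E} [IsFiniteMeasure μ] [NeZero μ] {R : ℝ}

/-- Time is `s`, with parameter `l - s`. The condition `S ≤ l` keeps the parameter nonnegative and
at most `|l|`, so the covariance bound bounds the derivative. -/
theorem isC1Field_tiltMean (hR : ∀ᵐ y ∂μ, ‖y‖ ≤ R) {l S : ℝ} (hSl : S ≤ l) :
    IsC1Field (fun s z => -tiltMean μ (l - s, z))
      (fun q => -((l - q.1) • tiltCov μ (l - q.1, q.2))) S (2 * R ^ 2 * |l|).toNNReal where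
  continuous_time z := ((continuous_tiltMean hR).comp (by fun_prop)).neg
  hasFDerivAt s z := (hasFDerivAt_tiltMean_right hR (l - s) z).neg
  continuous_fderiv := by
    have := (continuous_tiltCov hR).comp (by fun_prop : Continuous fun q : ℝ × E => (l - q.1, q.2))
    exact ((by fun_prop : Continuous fun q : ℝ × E => l - q.1).smul this).neg
  bound s hs z := by
    have h1 : 0 ≤ l - s := by linarith [hs.2]
    have h2 : l - s ≤ |l| := by linarith [hs.1, le_abs_self l]
    rw [norm_neg, norm_smul, Real.norm_of_nonneg h1, Real.coe_toNNReal _ (by positivity), mul_comm]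
    exact mul_le_mul (norm_tiltCov_le hR _) h2 h1 (by positivity)

/-- The flow of `tiltMean μ`, with the parameter decreasing from `l` to `l - S`: it is a `C¹`
bi-Lipschitz diffeomorphism, and transports `tiltDensity μ (l, ·)` to `tiltDensity μ (l - S, ·)`. -/
theorem exists_tiltFlow (hR : ∀ᵐ y ∂μ, ‖y‖ ≤ R) {l S : ℝ} (hS : 0 ≤ S) (hSl : S ≤ l) :
    ∃ Z : ℝ → E → E, (∀ x, Z 0 x = x) ∧
      (∀ x, IsIntegralCurveOn (Z · x) (fun s z => -tiltMean μ (l - s, z)) (Icc 0 S)) ∧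
      ∃ W : E → E, Function.LeftInverse W (Z S) ∧ Function.RightInverse W (Z S) ∧
        ContDiff ℝ 1 (Z S) ∧ ContDiff ℝ 1 W ∧
        (∃ C : ℝ, 0 < C ∧ (∀ x y, ‖Z S x - Z S y‖ ≤ C * ‖x - y‖) ∧
          ∀ x y, ‖W x - W y‖ ≤ C * ‖x - y‖) ∧
        ∀ x, tiltDensity μ (l - S, Z S x) * (fderiv ℝ (Z S) x).det = tiltDensity μ (l, x) := by
  have : CompleteSpace E := FiniteDimensional.complete ℝ E
  have hF := isC1Field_tiltMean hR hSl
  have hG := hF.reverse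
  have hlF : ∀ t ∈ Icc 0 S, LipschitzWith _ _ := fun t ht => hF.lipschitz ht
  have hlG : ∀ t ∈ Icc 0 S, LipschitzWith _ _ := fun t ht => hG.lipschitz ht
  have hSm : S ∈ Icc 0 S := ⟨hS, le_rfl⟩
  obtain ⟨Z, hZ0, hZ⟩ := hF.exists_flow hS
  obtain ⟨W, hW0, hW⟩ := hG.exists_flow hS
  obtain ⟨J, hJ0, hJ, hJd⟩ := hF.exists_fderiv_flow hS hZ0 hZ
  obtain ⟨J', -, -, hJd'⟩ := hG.exists_fderiv_flow hS hW0 hW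
  obtain ⟨hWZ, hZW⟩ := reverse_flow_leftInverse hS hlF hZ0 hZ hW0 hW
  refine ⟨Z, hZ0, hZ, W S, hWZ, hZW,
    contDiff_one_iff_hasFDerivAt.2 ⟨J S, (hJd S hSm).2, (hJd S hSm).1⟩,
    contDiff_one_iff_hasFDerivAt.2 ⟨J' S, (hJd' S hSm).2, (hJd' S hSm).1⟩,
    ⟨Real.exp ((2 * R ^ 2 * |l|).toNNReal * S), Real.exp_pos _, fun x y => ?_, fun x y => ?_⟩, fun x => ?_⟩
  · have := dist_integralCurves_le hlF (hZ x) (hZ y) S hSm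
    rwa [hZ0, hZ0, mul_comm] at this
  · have := dist_integralCurves_le hlG (hW x) (hW y) S hSm
    rwa [hW0, hW0, mul_comm] at this
  · have hderiv : ∀ (t : ℝ) (z : E), ∃ D : ℝ × E →L[ℝ] ℝ,
        HasFDerivAt (fun q : ℝ × E => tiltDensity μ (l - q.1, q.2)) D (t, z) ∧
        D (1, -tiltMean μ (l - t, z)) + tiltDensity μ (l - t, z) *
          LinearMap.trace ℝ E (-((l - t) • tiltCov μ (l - t, z)) : E →L[ℝ] E) = 0 := by
      intro t z
      obtain ⟨D, hD, hDe⟩ := tiltDensity_continuity_equation hR (l - t, z)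
      have hc : HasFDerivAt (fun q : ℝ × E => (l - q.1, q.2))
          ((-ContinuousLinearMap.fst ℝ ℝ E).prod (ContinuousLinearMap.snd ℝ ℝ E)) (t, z) :=
        (hasFDerivAt_fst.const_sub l).prodMk hasFDerivAt_snd
      refine ⟨_, HasFDerivAt.comp (g := tiltDensity μ) (f := fun q : ℝ × E => (l - q.1, q.2))
        (t, z) hD hc, ?_⟩
      -- Parameter and velocity both change sign, so the continuity equation for the reversed
      -- parameter is minus the original one.
      have hv : ((-ContinuousLinearMap.fst ℝ ℝ E).prod (ContinuousLinearMap.snd ℝ ℝ E))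
          ((1, -tiltMean μ (l - t, z)) : ℝ × E) = -(1, tiltMean μ (l - t, z)) := by
        ext <;> simp
      rw [ContinuousLinearMap.comp_apply, hv, map_neg, ContinuousLinearMap.toLinearMap_neg, map_neg,
        mul_neg, ← neg_add, neg_eq_zero]
      exact hDe
    have := continuity_equation_along_flow
      (A := fun q => -((l - q.1) • tiltCov μ (l - q.1, q.2))) (ρ := fun q : ℝ × E => tiltDensity μ (l - q.1, q.2))
      (hZ x) (hJ x)
      (fun q => (hderiv q.1 q.2).choose_spec.1.differentiableAt) (fun t z => by
        have h := (hderiv t z).choose_spec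
        rw [h.1.fderiv]
        exact h.2) S hSm
    rw [((hJd S hSm).1 x).fderiv, this]
    simp [hZ0, hJ0, ContinuousLinearMap.det]

end TiltFlow

/-! ### Gaussian mixtures, their marginals and their scores. -/

section GaussianMixtures

variable {n : ℕ}

theorem integral_isoGaussianDensity {v : ℝ} (hv : 0 < v) :
    ∫ x : Rn n, isoGaussianDensity v x = 1 := by
  have h := GaussianFourier.integral_rexp_neg_mul_sq_norm (V := Rn n)
    (b := (2 * v)⁻¹) (by positivity)
  unfold isoGaussianDensity
  have h2 : ∀ x : Rn n, -‖x‖ ^ 2 / (2 * v) = -(2 * v)⁻¹ * ‖x‖ ^ 2 := fun x => by ring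
  simp_rw [h2]
  rw [integral_const_mul, h, finrank_euclideanSpace_fin,
    show Real.pi / (2 * v)⁻¹ = 2 * Real.pi * v by field_simp, ← Real.rpow_add (by positivity),
    neg_div, neg_add_cancel, Real.rpow_zero]

theorem isPDF_isoGaussianDensity {v : ℝ} (hv : 0 < v) :
    IsPDF (isoGaussianDensity v : Rn n → ℝ) :=
  ⟨isoGaussianDensity_nonneg hv, integrable_isoGaussianDensity hv, integral_isoGaussianDensity hv⟩

/-- Completing the square in a product of two isotropic Gaussian densities. -/
theorem isoGaussianDensity_mul {v s : ℝ} (hv : 0 < v) (hs : 0 < s) (a : ℝ) (X Y : Rn n) :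
    isoGaussianDensity v Y * isoGaussianDensity s (X - a • Y) =
      isoGaussianDensity (a ^ 2 * v + s) X *
        isoGaussianDensity (v * s / (a ^ 2 * v + s)) (Y - (a * v / (a ^ 2 * v + s)) • X) := by
  have hw : 0 < a ^ 2 * v + s := by positivity
  unfold isoGaussianDensity
  rw [mul_mul_mul_comm]
  conv_rhs => rw [mul_mul_mul_comm]
  rw [← Real.exp_add, ← Real.exp_add,
    ← Real.mul_rpow (by positivity) (by positivity),
    ← Real.mul_rpow (by positivity) (by positivity)]
  congr 2
  · field_simp
  · rw [norm_sub_sq_real, norm_sub_sq_real, norm_smul, norm_smul, inner_smul_right,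
      inner_smul_right, mul_pow, mul_pow, Real.norm_eq_abs, Real.norm_eq_abs, sq_abs, sq_abs,
      real_inner_comm X Y]
    field_simp
    ring

/-- Completing the square leaves a factor free of `y` and a Gaussian in `y` of total mass one. -/
theorem integral_isoGaussianDensity_mul {v s : ℝ} (hv : 0 < v) (hs : 0 < s) (a : ℝ)
    (x u : Rn n) :
    ∫ y, isoGaussianDensity v (y - u) * isoGaussianDensity s (x - a • y) =
      isoGaussianDensity (a ^ 2 * v + s) (x - a • u) := by
  have hw : 0 < a ^ 2 * v + s := by positivity
  have h1 : ∀ y, isoGaussianDensity v (y - u) * isoGaussianDensity s (x - a • y) =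
      isoGaussianDensity (a ^ 2 * v + s) (x - a • u) *
        isoGaussianDensity (v * s / (a ^ 2 * v + s))
          (y - (u + (a * v / (a ^ 2 * v + s)) • (x - a • u))) := by
    intro y
    rw [← sub_sub, ← isoGaussianDensity_mul hv hs a (x - a • u) (y - u)]
    congr 2
    module
  simp_rw [h1]
  rw [integral_const_mul, integral_sub_right_eq_self, integral_isoGaussianDensity (by positivity),
    mul_one]

/-- The Gaussian mixture `x ↦ ∫ φ_s(x - a y) dμ(y)`. -/
noncomputable def mixtureDensity (μ : Measure (Rn n)) (s a : ℝ) (x : Rn n) : ℝ :=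
  ∫ y, isoGaussianDensity s (x - a • y) ∂μ

variable {μ : Measure (Rn n)} [IsProbabilityMeasure μ]

theorem continuous_mixture_kernel (s a : ℝ) :
    Continuous fun q : Rn n × Rn n => isoGaussianDensity s (q.1 - a • q.2) :=
  (continuous_isoGaussianDensity s).comp (by fun_prop)

theorem integrable_mixture_kernel_prod {s : ℝ} (hs : 0 < s) (a : ℝ) :
    Integrable (fun q : Rn n × Rn n => isoGaussianDensity s (q.1 - a • q.2))
      (volume.prod μ) := by
  rw [integrable_prod_iff' (continuous_mixture_kernel s a).aestronglyMeasurable]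
  refine ⟨Filter.Eventually.of_forall fun u =>
    Integrable.comp_sub_right (f := isoGaussianDensity s) (integrable_isoGaussianDensity hs)
      (a • u), ?_⟩
  have hnorm : ∀ x : Rn n, ‖isoGaussianDensity s x‖ = isoGaussianDensity s x := fun x =>
    Real.norm_of_nonneg (isoGaussianDensity_nonneg hs x)
  simp only [hnorm]
  have : ∀ u : Rn n, ∫ y, isoGaussianDensity s (y - a • u) = 1 := fun u => by
    rw [integral_sub_right_eq_self, integral_isoGaussianDensity hs]
  simp_rw [this]
  exact integrable_const 1

theorem isPDF_mixtureDensity {s : ℝ} (hs : 0 < s) (a : ℝ) : IsPDF (mixtureDensity μ s a) where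
  nonneg x := integral_nonneg fun y => isoGaussianDensity_nonneg hs _
  integrable := (integrable_mixture_kernel_prod hs a).integral_prod_left
  integral_eq_one := by
    unfold mixtureDensity
    rw [integral_integral_swap (integrable_mixture_kernel_prod hs a)]
    simp_rw [integral_sub_right_eq_self (isoGaussianDensity s : Rn n → ℝ),
      integral_isoGaussianDensity hs]
    simp

/-- The variance `e^{-t} v + 1 - e^{-t}` at time `t` of the diffusion started from `𝒩(0, v)`. -/
noncomputable def vpVar (v t : ℝ) : ℝ := Real.exp (-t) * v + (1 - Real.exp (-t))

theorem vpVar_pos {v t : ℝ} (hv : 0 < v) (ht : 0 ≤ t) : 0 < vpVar v t := by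
  have : Real.exp (-t) ≤ 1 := Real.exp_le_one_iff.2 (by linarith)
  unfold vpVar
  have := mul_pos (Real.exp_pos (-t)) hv
  linarith

/-- By Fubini each Gaussian component diffuses separately, so the mixing measure never changes. -/
theorem vpDensity_mixtureDensity {v t : ℝ} (hv : 0 < v) (ht : 0 ≤ t) :
    vpDensity (mixtureDensity μ v 1) t = mixtureDensity μ (vpVar v t) (Real.exp (-t / 2)) := by
  ext x
  rcases ht.eq_or_lt with rfl | ht
  · simp [vpDensity, vpVar]
  have hs : 0 < 1 - Real.exp (-t) := by
    rw [sub_pos, Real.exp_lt_one_iff]; linarith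
  set a := Real.exp (-t / 2) with ha
  have ha2 : a ^ 2 = Real.exp (-t) := by
    rw [ha, ← Real.exp_nat_mul]; congr 1; push_cast; ring
  rw [vpDensity, if_neg (not_le.2 ht)]
  unfold mixtureDensity
  simp_rw [← integral_mul_const]
  rw [integral_integral_swap]
  · refine integral_congr_ae (Filter.Eventually.of_forall fun u => ?_)
    simp only [one_smul]
    rw [integral_isoGaussianDensity_mul hv hs a x u, ha2, vpVar]
  · refine (integrable_mixture_kernel_prod hv 1).mul_bdd
      (c := (2 * Real.pi * (1 - Real.exp (-t))) ^ (-(n : ℝ) / 2)) ?_ ?_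
    · exact ((continuous_isoGaussianDensity _).comp
        (by fun_prop : Continuous fun q : Rn n × Rn n => x - a • q.1)).aestronglyMeasurable
    · refine Filter.Eventually.of_forall fun q => ?_
      rw [Real.norm_of_nonneg (isoGaussianDensity_nonneg hs _)]
      exact isoGaussianDensity_le hs _

omit [IsProbabilityMeasure μ] in
-- Expanding `‖x - a y‖² / w²`: up to normalisation and scaling of `x`, the pair `(w, a)` enters
-- only through `a / w`. This reduces all marginals to a one-parameter family.
theorem mixtureDensity_eq_tiltDensity {w : ℝ} (hw : 0 < w) (a : ℝ) (x : Rn n) :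
    mixtureDensity μ (w ^ 2) a x =
      (2 * Real.pi * w ^ 2) ^ (-(n : ℝ) / 2) * tiltDensity μ (a / w, w⁻¹ • x) := by
  rw [mixtureDensity, tiltDensity, tiltMass, tiltIntegral, ← integral_const_mul,
    ← integral_const_mul]
  refine integral_congr_ae (Filter.Eventually.of_forall fun y => ?_)
  simp only [isoGaussianDensity, tiltWeight, smul_eq_mul, mul_one]
  rw [← Real.exp_add]
  congr 2
  rw [norm_sub_sq_real, norm_smul, norm_smul, inner_smul_right, inner_smul_left, mul_pow, mul_pow,
    Real.norm_eq_abs, Real.norm_eq_abs, sq_abs, sq_abs]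
  simp only [conj_trivial]
  field_simp
  ring

/-- The gradient of the logarithm of a Gaussian mixture. -/
theorem hasGradientAt_log_mixtureDensity {R : ℝ} (hR : ∀ᵐ y ∂μ, ‖y‖ ≤ R) {w : ℝ} (hw : 0 < w)
    (a : ℝ) (x : Rn n) :
    0 < mixtureDensity μ (w ^ 2) a x ∧ DifferentiableAt ℝ (mixtureDensity μ (w ^ 2) a) x ∧
    HasGradientAt (fun x => Real.log (mixtureDensity μ (w ^ 2) a x))
      (-(w ^ 2)⁻¹ • x + (a / w ^ 2) • tiltMean μ (a / w, w⁻¹ • x)) x := by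
  have hfun : mixtureDensity μ (w ^ 2) a = fun x =>
      (2 * Real.pi * w ^ 2) ^ (-(n : ℝ) / 2) * tiltDensity μ (a / w, w⁻¹ • x) :=
    funext fun x => mixtureDensity_eq_tiltDensity hw a x
  rw [hfun]
  have hC : 0 < (2 * Real.pi * w ^ 2) ^ (-(n : ℝ) / 2) := by positivity
  have hpos : ∀ z : Rn n, 0 < tiltDensity μ (a / w, z) := fun z => tiltDensity_pos hR _
  have hd : ∀ z : Rn n, HasFDerivAt (fun z => tiltDensity μ (a / w, z))
      (tiltDensity μ (a / w, z) • innerSL ℝ (-z + (a / w) • tiltMean μ (a / w, z))) z := by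
    intro z
    have hexp := ((hasStrictFDerivAt_norm_sq z).hasFDerivAt.neg.mul_const (2⁻¹ : ℝ)).exp
    simp only [tiltDensity, div_eq_mul_inv _ (2 : ℝ)]
    refine (hexp.mul (hasFDerivAt_tiltMass_right hR (a / w) z)).congr_fderiv ?_
    have hM : tiltIntegral μ (fun y => y) (a / w, z) =
        tiltMass μ (a / w, z) • tiltMean μ (a / w, z) := by
      rw [tiltMean, smul_inv_smul₀ (tiltMass_pos hR _).ne']
    rw [hM]
    ext h
    simp only [map_add, map_neg, map_smul, add_apply, smul_apply, neg_apply, smul_eq_mul,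
      innerSL_apply_apply, nsmul_eq_mul, Pi.neg_apply]
    push_cast
    ring
  have hx : HasFDerivAt (fun x : Rn n => w⁻¹ • x) (w⁻¹ • ContinuousLinearMap.id ℝ (Rn n)) x :=
    (hasFDerivAt_id x).const_smul w⁻¹
  have h1 := (HasFDerivAt.comp (g := fun z => tiltDensity μ (a / w, z))
    (f := fun x : Rn n => w⁻¹ • x) x (hd _) hx).const_mul
      ((2 * Real.pi * w ^ 2) ^ (-(n : ℝ) / 2))
  have h2 := h1.log (mul_pos hC (hpos _)).ne'
  refine ⟨mul_pos hC (hpos _), h1.differentiableAt, ?_⟩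
  rw [hasGradientAt_iff_hasFDerivAt]
  refine h2.congr_fderiv ?_
  have h0 := (hpos (w⁻¹ • x)).ne'
  ext h
  simp only [Function.comp_apply, smul_apply, ContinuousLinearMap.comp_apply, map_add, map_neg,
    map_smul, add_apply, neg_apply, smul_eq_mul, InnerProductSpace.toDual_apply_apply,
    innerSL_apply_apply, ContinuousLinearMap.id_apply]
  generalize tiltDensity μ (a / w, w⁻¹ • x) = D at h0
  generalize tiltMean μ (a / w, w⁻¹ • x) = m
  field_simp

theorem score_mixtureDensity {R : ℝ} (hR : ∀ᵐ y ∂μ, ‖y‖ ≤ R) {v t : ℝ} (hv : 0 < v)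
    (ht : 0 ≤ t) :
    score (mixtureDensity μ v 1) t = fun x => -(vpVar v t)⁻¹ • x +
      (Real.exp (-t / 2) / vpVar v t) •
        tiltMean μ (Real.exp (-t / 2) / √(vpVar v t), (√(vpVar v t))⁻¹ • x) := by
  have hw := Real.sqrt_pos.2 (vpVar_pos hv ht)
  ext1 x
  have h := (hasGradientAt_log_mixtureDensity hR hw (Real.exp (-t / 2)) x).2.2.gradient
  rw [Real.sq_sqrt (vpVar_pos hv ht).le] at h
  rw [score, vpDensity_mixtureDensity hv ht, h]

theorem hasFDerivAt_score {R : ℝ} (hR : ∀ᵐ y ∂μ, ‖y‖ ≤ R) {v t : ℝ} (hv : 0 < v)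
    (ht : 0 ≤ t) (x : Rn n) :
    HasFDerivAt (score (mixtureDensity μ v 1) t)
      (-(vpVar v t)⁻¹ • ContinuousLinearMap.id ℝ (Rn n) + (Real.exp (-t) / vpVar v t ^ 2) •
        tiltCov μ (Real.exp (-t / 2) / √(vpVar v t), (√(vpVar v t))⁻¹ • x)) x := by
  have hw0 := vpVar_pos hv ht
  have hw := Real.sqrt_pos.2 hw0
  rw [score_mixtureDensity hR hv ht]
  set w := √(vpVar v t) with hwd
  have hw2 : vpVar v t = w ^ 2 := (Real.sq_sqrt hw0.le).symm
  have ha2 : Real.exp (-t) = Real.exp (-t / 2) ^ 2 := by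
    rw [← Real.exp_nat_mul]; congr 1; push_cast; ring
  rw [hw2, ha2]
  have hx : HasFDerivAt (fun x : Rn n => w⁻¹ • x) (w⁻¹ • ContinuousLinearMap.id ℝ (Rn n)) x :=
    (hasFDerivAt_id x).const_smul w⁻¹
  have h1 := (HasFDerivAt.comp (g := fun z => tiltMean μ (Real.exp (-t / 2) / w, z))
    (f := fun x : Rn n => w⁻¹ • x) x (hasFDerivAt_tiltMean_right hR _ _) hx).const_smul
      (Real.exp (-t / 2) / w ^ 2)
  refine (((hasFDerivAt_id x).const_smul (-(w ^ 2)⁻¹)).add h1).congr_fderiv ?_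
  ext1 h
  simp only [add_apply, smul_apply, ContinuousLinearMap.comp_apply, ContinuousLinearMap.id_apply,
    map_smul, smul_smul]
  congr 2
  field_simp

theorem le_vpVar {v t : ℝ} (hv1 : v ≤ 1) (ht : 0 ≤ t) : v ≤ vpVar v t := by
  have : Real.exp (-t) ≤ 1 := Real.exp_le_one_iff.2 (by linarith)
  unfold vpVar
  nlinarith

/-- The variance is a convex combination of `v` and 1, hence at least `v`; with `e^{-t} ≤ 1` and the
covariance bound this controls the derivative of the score independently of `T`. -/
theorem hasUniformlyLipschitzScores_mixtureDensity {R : ℝ} (hR : ∀ᵐ y ∂μ, ‖y‖ ≤ R) {v : ℝ}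
    (hv : 0 < v) (hv1 : v ≤ 1) (T : ℝ) :
    HasUniformlyLipschitzScores (mixtureDensity μ v 1) T ∧
      ∀ t ∈ Icc 0 T, ∀ x, ‖fderiv ℝ (score (mixtureDensity μ v 1) t) x‖ ≤
        v⁻¹ + 1 / v ^ 2 * (2 * R ^ 2) := by
  have hb : ∀ t ∈ Icc 0 T, ∀ x, ‖fderiv ℝ (score (mixtureDensity μ v 1) t) x‖ ≤
      v⁻¹ + 1 / v ^ 2 * (2 * R ^ 2) := by
    intro t ht x
    have hle : v ≤ vpVar v t := le_vpVar hv1 ht.1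
    have hw0 := vpVar_pos hv ht.1
    rw [(hasFDerivAt_score hR hv ht.1 x).fderiv]
    refine (norm_add_le _ _).trans (add_le_add ?_ ?_)
    · rw [norm_smul, norm_neg, norm_inv, Real.norm_of_nonneg hw0.le]
      refine (mul_le_of_le_one_right (by positivity) ContinuousLinearMap.norm_id_le).trans ?_
      gcongr
    · rw [norm_smul, Real.norm_of_nonneg (by positivity)]
      gcongr
      · exact Real.exp_le_one_iff.2 (by linarith [ht.1])
      · exact norm_tiltCov_le hR _
  refine ⟨⟨fun t ht => ?_, _, hb⟩, hb⟩
  have hw0 := vpVar_pos hv ht.1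
  have h := fun x => hasGradientAt_log_mixtureDensity hR (Real.sqrt_pos.2 hw0)
    (Real.exp (-t / 2)) x
  rw [Real.sq_sqrt hw0.le] at h
  rw [vpDensity_mixtureDensity hv ht.1]
  exact ⟨fun x => (h x).1, fun x => (h x).2.1,
    fun x => (hasFDerivAt_score hR hv ht.1 x).differentiableAt⟩

end GaussianMixtures

/-! ### The probability flow as a time-changed tilt flow. -/

section ProbabilityFlow

variable {n : ℕ}

/-- The signal-to-noise parameter `e^{-t/2} / √(vpVar v t)`. -/
noncomputable def vpSignal (v t : ℝ) : ℝ := Real.exp (-t / 2) / √(vpVar v t)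

theorem hasDerivAt_vpVar (v t : ℝ) : HasDerivAt (vpVar v) (Real.exp (-t) * (1 - v)) t := by
  have h : HasDerivAt (fun t : ℝ => Real.exp (-t)) (-Real.exp (-t)) t := by
    simpa using (hasDerivAt_neg t).exp
  exact ((h.mul_const v).add (h.const_sub 1)).congr_deriv (by ring)

theorem hasDerivAt_sqrt_vpVar {v t : ℝ} (hv : 0 < v) (ht : 0 ≤ t) :
    HasDerivAt (fun t => √(vpVar v t)) ((1 - vpVar v t) / (2 * √(vpVar v t))) t := by
  refine ((hasDerivAt_vpVar v t).sqrt (vpVar_pos hv ht).ne').congr_deriv ?_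
  rw [vpVar]
  ring

/-- This is exactly the coefficient of the tilted mean in the probability flow for `z = x / √(vpVar
v t)`, so the signal is the right clock. -/
theorem hasDerivAt_vpSignal {v t : ℝ} (hv : 0 < v) (ht : 0 ≤ t) :
    HasDerivAt (vpSignal v) (-(Real.exp (-t / 2) / (2 * √(vpVar v t) ^ 3))) t := by
  have hw0 := vpVar_pos hv ht
  have hw := Real.sqrt_pos.2 hw0
  have ha : HasDerivAt (fun t : ℝ => Real.exp (-t / 2)) (Real.exp (-t / 2) * (-1 / 2)) t :=
    ((hasDerivAt_neg t).div_const 2).exp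
  refine (ha.div (hasDerivAt_sqrt_vpVar hv ht) hw.ne').congr_deriv ?_
  have h2 : vpVar v t = √(vpVar v t) ^ 2 := (Real.sq_sqrt hw0.le).symm
  generalize √(vpVar v t) = w at hw h2 ⊢
  rw [h2]
  field_simp
  ring

/-- Monotonicity makes `l - vpSignal v t` an admissible time for the tilt flow. -/
theorem antitoneOn_vpSignal {v : ℝ} (hv : 0 < v) : AntitoneOn (vpSignal v) (Ici 0) := by
  refine antitoneOn_of_deriv_nonpos (convex_Ici 0)
    (fun t ht => (hasDerivAt_vpSignal hv ht).continuousAt.continuousWithinAt)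
    (fun t ht => (hasDerivAt_vpSignal hv
      (interior_subset ht)).differentiableAt.differentiableWithinAt) fun t ht => ?_
  rw [(hasDerivAt_vpSignal hv (interior_subset ht)).deriv, neg_nonpos]
  positivity

variable {μ : Measure (Rn n)} [IsProbabilityMeasure μ] {R : ℝ}

theorem exists_lipschitz_velocity (hR : ∀ᵐ y ∂μ, ‖y‖ ≤ R) {v : ℝ} (hv : 0 < v) (hv1 : v ≤ 1)
    (T : ℝ) : ∃ K : ℝ≥0, ∀ t ∈ Icc 0 T, LipschitzWith K (velocity (mixtureDensity μ v 1) t) := by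
  obtain ⟨⟨hd, -⟩, hb⟩ := hasUniformlyLipschitzScores_mixtureDensity hR hv hv1 T
  have hM : 0 ≤ v⁻¹ + 1 / v ^ 2 * (2 * R ^ 2) := by positivity
  refine ⟨1 + (v⁻¹ + 1 / v ^ 2 * (2 * R ^ 2)).toNNReal, fun t ht => ?_⟩
  have hs : LipschitzWith (v⁻¹ + 1 / v ^ 2 * (2 * R ^ 2)).toNNReal
      (score (mixtureDensity μ v 1) t) :=
    lipschitzWith_of_nnnorm_fderiv_le (𝕜 := ℝ) (hd t ht).2.2 fun x => by
      rw [← NNReal.coe_le_coe, Real.coe_toNNReal _ hM]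
      exact hb t ht x
  refine LipschitzWith.of_dist_le_mul fun x y => ?_
  have h := hs.dist_le_mul x y
  rw [dist_eq_norm, dist_eq_norm, Real.coe_toNNReal _ hM] at *
  have heq : velocity (mixtureDensity μ v 1) t x - velocity (mixtureDensity μ v 1) t y =
      (-(1 / 2) : ℝ) • (x - y) - (1 / 2 : ℝ) •
        (score (mixtureDensity μ v 1) t x - score (mixtureDensity μ v 1) t y) := by
    unfold velocity; module
  rw [heq]
  refine (norm_sub_le _ _).trans ?_
  rw [norm_smul, norm_smul, norm_neg, Real.norm_of_nonneg (by norm_num : (0 : ℝ) ≤ 1 / 2)]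
  push_cast
  rw [Real.coe_toNNReal _ hM]
  have := norm_nonneg (x - y)
  have := norm_nonneg (score (mixtureDensity μ v 1) t x - score (mixtureDensity μ v 1) t y)
  linarith

theorem isBiLipschitzC1Diffeo_of_lipschitz {f g : Rn n → Rn n} (h1 : Function.LeftInverse g f)
    (h2 : Function.RightInverse g f) (hf : ContDiff ℝ 1 f) (hg : ContDiff ℝ 1 g) {C D : ℝ}
    (hC : ∀ x y, ‖f x - f y‖ ≤ C * ‖x - y‖) (hD : ∀ x y, ‖g x - g y‖ ≤ D * ‖x - y‖) :
    IsBiLipschitzC1Diffeo f g := by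
  -- The lower bound is the Lipschitz bound of the inverse; taking the maximum with 1 makes the
  -- constants positive and ordered.
  have hM : 1 ≤ max 1 (max C D) := le_max_left _ _
  have hM0 : 0 < max 1 (max C D) := one_pos.trans_le hM
  refine ⟨h1, h2, hf, hg, (max 1 (max C D))⁻¹, max 1 (max C D), inv_pos.2 hM0,
    (inv_le_one_of_one_le₀ hM).trans hM, fun x y => ⟨?_, ?_⟩⟩
  · rw [inv_mul_le_iff₀ hM0]
    have := hD (f x) (f y)
    rw [h1, h1] at this
    refine this.trans ?_
    gcongr
    exact (le_max_right _ _).trans (le_max_right _ _)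
  · refine (hC x y).trans ?_
    gcongr
    exact (le_max_left _ _).trans (le_max_right _ _)

/-- The probability flow started from the mixture `φ_v * μ` exists, is unique, is a bi-Lipschitz
`C¹`-diffeomorphism, and transports the marginal densities. -/
theorem exists_probabilityFlow (hR : ∀ᵐ y ∂μ, ‖y‖ ≤ R) {v T : ℝ} (hv : 0 < v) (hv1 : v ≤ 1)
    (hT : 0 ≤ T) :
    ∃ (φ : ℝ → Rn n → Rn n) (ψ : Rn n → Rn n),
      IsProbabilityFlow (mixtureDensity μ v 1) T φ ∧ IsBiLipschitzC1Diffeo (φ T) ψ ∧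
      ∀ x, vpDensity (mixtureDensity μ v 1) T (φ T x) * |(fderiv ℝ (φ T) x).det| =
        mixtureDensity μ v 1 x := by
  set l := vpSignal v 0 with hl
  have hw0 : √(vpVar v 0) = √v := by simp [vpVar]
  have hsv : 0 < √v := Real.sqrt_pos.2 hv
  have hwT0 := vpVar_pos hv hT
  have hwT := Real.sqrt_pos.2 hwT0
  have hmem : ∀ t ∈ Icc 0 T, l - vpSignal v t ∈ Icc 0 (l - vpSignal v T) := by
    intro t ht
    have h1 := antitoneOn_vpSignal hv (mem_Ici.2 le_rfl) (mem_Ici.2 ht.1) ht.1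
    have h2 := antitoneOn_vpSignal hv (mem_Ici.2 ht.1) (mem_Ici.2 hT) ht.2
    exact ⟨by linarith, by linarith⟩
  have hsig : 0 < vpSignal v T := div_pos (Real.exp_pos _) hwT
  obtain ⟨Z, hZ0, hZ, W, hWZ, hZW, hZc, hWc, ⟨C, hC, hZl, hWl⟩, hdet⟩ :=
    exists_tiltFlow hR (l := l) (hmem T ⟨hT, le_rfl⟩).1 (by linarith)
  set S := l - vpSignal v T with hS
  set φ : ℝ → Rn n → Rn n :=
    fun t x => √(vpVar v t) • Z (l - vpSignal v t) ((√v)⁻¹ • x) with hφ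
  have hsol : ∀ x, IsIntegralCurveOn (fun t => φ t x) (velocity (mixtureDensity μ v 1))
      (Icc 0 T) := by
    intro x t ht
    have hVp := vpVar_pos hv ht.1
    have hwp := Real.sqrt_pos.2 hVp
    have h1 := (hZ ((√v)⁻¹ • x) _ (hmem t ht)).scomp t
      ((hasDerivAt_vpSignal hv ht.1).const_sub l).hasDerivWithinAt hmem
    have h2 := (hasDerivAt_sqrt_vpVar hv ht.1).hasDerivWithinAt.smul h1
    -- The derivative of `√(vpVar v t)` produces the linear part of the velocity, that of the signal
    -- the part along the tilted mean.
    refine h2.congr_deriv ?_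
    rw [velocity, score_mixtureDensity hR hv ht.1]
    simp only [hφ, Function.comp_apply, sub_sub_cancel, inv_smul_smul₀ hwp.ne']
    have hsd : Real.exp (-t / 2) / √(vpVar v t) = vpSignal v t := rfl
    rw [hsd]
    generalize Z (l - vpSignal v t) ((√v)⁻¹ • x) = z
    generalize tiltMean μ (vpSignal v t, z) = m
    have hV : vpVar v t = √(vpVar v t) ^ 2 := (Real.sq_sqrt hVp.le).symm
    generalize √(vpVar v t) = w at hwp hV ⊢
    rw [hV]
    match_scalars
    · field_simp
    · field_simp
      ring
  have hinit : ∀ x, φ 0 x = x := fun x => by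
    simp only [hφ, ← hl, sub_self, hZ0, hw0, smul_inv_smul₀ hsv.ne']
  have hφT : φ T = fun x => √(vpVar v T) • Z S ((√v)⁻¹ • x) := rfl
  refine ⟨φ, fun x => √v • W ((√(vpVar v T))⁻¹ • x), ⟨hinit, hsol, ?_⟩, ?_, ?_⟩
  · intro x γ hγ0 hγ t ht
    obtain ⟨K, hK⟩ := exists_lipschitz_velocity hR hv hv1 T
    exact integralCurves_eq hK hγ (hsol x) (by rw [hγ0, hinit]) t ht
  · rw [hφT]
    refine isBiLipschitzC1Diffeo_of_lipschitz (fun x => ?_) (fun x => ?_)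
      ((hZc.comp (contDiff_const_smul _)).const_smul _)
      ((hWc.comp (contDiff_const_smul _)).const_smul _)
      (C := √(vpVar v T) * (C * (√v)⁻¹)) (D := √v * (C * (√(vpVar v T))⁻¹))
      (fun x y => ?_) (fun x y => ?_)
    · simp only [inv_smul_smul₀ hwT.ne', hWZ _, smul_inv_smul₀ hsv.ne']
    · simp only [inv_smul_smul₀ hsv.ne', hZW _, smul_inv_smul₀ hwT.ne']
    · rw [← smul_sub, norm_smul, Real.norm_of_nonneg hwT.le, mul_assoc]
      gcongr
      refine (hZl _ _).trans_eq ?_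
      rw [← smul_sub, norm_smul, norm_inv, Real.norm_of_nonneg hsv.le, mul_assoc]
    · rw [← smul_sub, norm_smul, Real.norm_of_nonneg hsv.le, mul_assoc]
      gcongr
      refine (hWl _ _).trans_eq ?_
      rw [← smul_sub, norm_smul, norm_inv, Real.norm_of_nonneg hwT.le, mul_assoc]
  · intro x
    have hx : HasFDerivAt (fun x : Rn n => (√v)⁻¹ • x) ((√v)⁻¹ • ContinuousLinearMap.id ℝ (Rn n))
        x := (hasFDerivAt_id x).const_smul (√v)⁻¹
    have hd := (HasFDerivAt.comp (g := Z S) (f := fun x : Rn n => (√v)⁻¹ • x) x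
      ((hZc.differentiable one_ne_zero) _).hasFDerivAt hx).const_smul (√(vpVar v T))
    have hfd : (fderiv ℝ (φ T) x).det = √(vpVar v T) ^ n * ((√v) ^ n)⁻¹ *
        (fderiv ℝ (Z S) ((√v)⁻¹ • x)).det := by
      have h1 : fderiv ℝ (φ T) x = (√(vpVar v T) * (√v)⁻¹) • fderiv ℝ (Z S) ((√v)⁻¹ • x) := by
        rw [hφT]
        refine hd.fderiv.trans ?_
        ext1 h
        simp [smul_smul]
      rw [h1, ContinuousLinearMap.det, ContinuousLinearMap.toLinearMap_smul, LinearMap.det_smul,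
        finrank_euclideanSpace_fin, mul_pow, inv_pow]
    have hp : tiltDensity μ (vpSignal v T, Z S ((√v)⁻¹ • x)) *
        (fderiv ℝ (Z S) ((√v)⁻¹ • x)).det = tiltDensity μ (l, (√v)⁻¹ • x) := by
      rw [← hdet, hS, sub_sub_cancel]
    -- Transport between two positive densities forces a positive determinant, which removes the
    -- absolute value.
    have hdpos : 0 < (fderiv ℝ (Z S) ((√v)⁻¹ • x)).det := by
      have h1 := tiltDensity_pos hR (μ := μ) (vpSignal v T, Z S ((√v)⁻¹ • x))
      have h2 := tiltDensity_pos hR (μ := μ) (l, (√v)⁻¹ • x)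
      rw [← hp] at h2
      exact (pos_iff_pos_of_mul_pos h2).1 h1
    -- The Gaussian normalising constants carry factors `w⁻ⁿ`, which cancel the Jacobians of the two
    -- rescalings.
    have hpow : ∀ w : ℝ, 0 < w → (2 * Real.pi * w ^ 2) ^ (-(n : ℝ) / 2) =
        (2 * Real.pi) ^ (-(n : ℝ) / 2) * (w ^ n)⁻¹ := by
      intro w hw
      rw [Real.mul_rpow (by positivity) (by positivity), ← Real.rpow_natCast w 2,
        ← Real.rpow_mul hw.le, ← Real.rpow_natCast w n, ← Real.rpow_neg hw.le]
      congr 2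
      push_cast
      ring
    have e1 := mixtureDensity_eq_tiltDensity (μ := μ) hwT (Real.exp (-T / 2)) (φ T x)
    have e2 := mixtureDensity_eq_tiltDensity (μ := μ) hsv 1 x
    rw [Real.sq_sqrt hwT0.le] at e1
    rw [Real.sq_sqrt hv.le] at e2
    have hl' : 1 / √v = l := by rw [hl, vpSignal, hw0]; simp
    rw [vpDensity_mixtureDensity hv hT, e1, e2, hfd, abs_of_pos (by positivity), hl', ← hp, hφT]
    simp only [inv_smul_smul₀ hwT.ne']
    have hp1 := hpow _ hwT
    have hp2 := hpow _ hsv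
    rw [Real.sq_sqrt hwT0.le] at hp1
    rw [Real.sq_sqrt hv.le] at hp2
    rw [hp1, hp2]
    have hsd : Real.exp (-T / 2) / √(vpVar v T) = vpSignal v T := rfl
    rw [hsd]
    field_simp

end ProbabilityFlow

open Filter

/-! ### `L¹` approximation and change of variables. -/

section Approximation

variable {n : ℕ}

theorem IsPDF.isProbabilityMeasure {p : Rn n → ℝ} (hp : IsPDF p) :
    IsProbabilityMeasure (measureOfDensity p) := by
  constructor
  rw [measureOfDensity, withDensity_apply _ MeasurableSet.univ, Measure.restrict_univ,
    ← ofReal_integral_eq_lintegral_ofReal hp.integrable (Eventually.of_forall hp.nonneg),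
    hp.integral_eq_one, ENNReal.ofReal_one]

theorem isPDF_of_measureOfDensity {q : Rn n → ℝ} (h0 : ∀ x, 0 ≤ q x) (hq : Continuous q)
    [IsProbabilityMeasure (measureOfDensity q)] : IsPDF q := by
  have h1 : ∫⁻ x, ENNReal.ofReal (q x) = 1 := by
    rw [← Measure.restrict_univ (μ := volume), ← withDensity_apply _ MeasurableSet.univ]
    exact measure_univ (μ := measureOfDensity q)
  refine ⟨h0, ⟨hq.aestronglyMeasurable, ?_⟩, ?_⟩
  · rw [hasFiniteIntegral_iff_ofReal (Eventually.of_forall h0), h1]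
    exact ENNReal.one_lt_top
  · rw [integral_eq_lintegral_of_nonneg_ae (Eventually.of_forall h0) hq.aestronglyMeasurable, h1,
      ENNReal.toReal_one]

/-- Scheffé's lemma: densities converging pointwise to a density converge in `L¹`. -/
theorem tendsto_integral_abs_sub_of_isPDF {ι : Type*} {l : Filter ι} [l.IsCountablyGenerated]
    {F : ι → Rn n → ℝ} {f : Rn n → ℝ} (hF : ∀ᶠ i in l, IsPDF (F i)) (hf : IsPDF f)
    (h : ∀ x, Tendsto (F · x) l (𝓝 (f x))) :
    Tendsto (fun i => ∫ x, |F i x - f x|) l (𝓝 0) := by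
  have h1 : Tendsto (fun i => ∫ x, max (f x - F i x) 0) l (𝓝 (∫ _ : Rn n, (0 : ℝ))) := by
    refine tendsto_integral_filter_of_dominated_convergence f ?_ ?_ hf.integrable
      (Eventually.of_forall fun x => ?_)
    · filter_upwards [hF] with i hi
      exact ((hf.integrable.sub hi.integrable).pos_part).aestronglyMeasurable
    · filter_upwards [hF] with i hi
      refine Eventually.of_forall fun x => ?_
      rw [Real.norm_of_nonneg (le_max_right _ _)]
      exact max_le (by linarith [hi.nonneg x]) (hf.nonneg x)
    · have := ((tendsto_const_nhds (x := f x)).sub (h x)).max (tendsto_const_nhds (x := (0 : ℝ)))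
      simpa using this
  rw [integral_zero] at h1
  have h2 := h1.const_mul 2
  rw [mul_zero] at h2
  refine h2.congr' ?_
  filter_upwards [hF] with i hi
  have hint : Integrable (fun x => F i x - f x) := hi.integrable.sub hf.integrable
  have hpos : Integrable (fun x => max (f x - F i x) 0) :=
    (hf.integrable.sub hi.integrable).pos_part
  -- The first summand integrates to zero, both masses being one; the positive part is dominated by
  -- `f`.
  have hpt : ∀ x, |F i x - f x| = (F i x - f x) + 2 * max (f x - F i x) 0 := by
    intro x
    rcases le_total (f x) (F i x) with hx | hx
    · rw [abs_of_nonneg (by linarith), max_eq_right (by linarith)]; ring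
    · rw [abs_of_nonpos (by linarith), max_eq_left (by linarith)]; ring
  simp_rw [hpt]
  rw [integral_add hint (hpos.const_mul 2), integral_const_mul,
    integral_sub hi.integrable hf.integrable, hi.integral_eq_one, hf.integral_eq_one]
  simp

/-- Continuous compactly supported densities are dense among the densities, in `L¹`. -/
theorem exists_continuous_isPDF_near {p : Rn n → ℝ} (hp : IsPDF p) {ε : ℝ} (hε : 0 < ε) :
    ∃ g : Rn n → ℝ, IsPDF g ∧ Continuous g ∧ HasCompactSupport g ∧ ∫ x, |p x - g x| ≤ ε := by
  -- Truncation and renormalisation each cost at most `δ ≤ ε / 2`, while `δ ≤ 1 / 2` keeps the mass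
  -- `M` away from zero.
  have hδ : 0 < min (ε / 2) (1 / 2) := by positivity
  set δ := min (ε / 2) (1 / 2) with hδd
  obtain ⟨g₀, hcs, hle, hc, hi⟩ := hp.integrable.exists_hasCompactSupport_integral_sub_le hδ
  set g₁ : Rn n → ℝ := fun x => max (g₀ x) 0 with hg₁
  have hc₁ : Continuous g₁ := hc.max continuous_const
  have hcs₁ : HasCompactSupport g₁ := hcs.comp_left (g := fun r : ℝ => max r 0) (by simp)
  have hi₁ : Integrable g₁ := hi.pos_part
  have hle₁ : ∫ x, |p x - g₁ x| ≤ δ := by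
    refine (integral_mono (hp.integrable.sub hi₁).abs (hp.integrable.sub hi).norm
      fun x => ?_).trans hle
    have h0 := hp.nonneg x
    have := abs_max_sub_max_le_abs (p x) (g₀ x) 0
    rw [max_eq_left h0] at this
    exact this
  set M := ∫ x, g₁ x with hM
  have hM1 : |M - 1| ≤ δ := by
    rw [hM, ← hp.integral_eq_one, ← integral_sub hi₁ hp.integrable]
    refine (abs_integral_le_integral_abs).trans (le_of_eq_of_le ?_ hle₁)
    exact integral_congr_ae (Eventually.of_forall fun x => abs_sub_comm _ _)
  have hMpos : 0 < M := by
    have := (abs_le.1 hM1).1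
    have : δ ≤ 1 / 2 := min_le_right _ _
    linarith
  refine ⟨fun x => M⁻¹ * g₁ x, ⟨fun x => by positivity, hi₁.const_mul _, ?_⟩,
    continuous_const.mul hc₁, hcs₁.mul_left, ?_⟩
  · rw [integral_const_mul, ← hM, inv_mul_cancel₀ hMpos.ne']
  · have hstep : ∀ x, |p x - M⁻¹ * g₁ x| ≤ |p x - g₁ x| + |1 - M⁻¹| * g₁ x := by
      intro x
      have h0 : 0 ≤ g₁ x := le_max_right _ _
      calc |p x - M⁻¹ * g₁ x| = |(p x - g₁ x) + (1 - M⁻¹) * g₁ x| := by congr 1; ring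
        _ ≤ _ := (abs_add_le _ _).trans_eq (by rw [abs_mul, abs_of_nonneg h0])
    refine (integral_mono (hp.integrable.sub (hi₁.const_mul _)).abs
      ((hp.integrable.sub hi₁).abs.add (hi₁.const_mul _)) hstep).trans ?_
    have hadd := integral_add (hp.integrable.sub hi₁).abs (hi₁.const_mul |1 - M⁻¹|)
    simp only [Pi.sub_apply] at hadd
    simp only [Pi.add_apply, Pi.sub_apply]
    rw [hadd, integral_const_mul, ← hM]
    have : |1 - M⁻¹| * M = |M - 1| := by
      nth_rewrite 2 [← abs_of_pos hMpos]
      rw [← abs_mul, sub_mul, inv_mul_cancel₀ hMpos.ne', one_mul]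
    rw [this]
    have : δ ≤ ε / 2 := min_le_left _ _
    linarith

/-- The mixture is the expectation of `g (x - √v Z)` with `Z` standard Gaussian, and `g` is bounded
and continuous. -/
theorem tendsto_mixtureDensity_zero {g : Rn n → ℝ} (hg : IsPDF g) (hc : Continuous g)
    (hcs : HasCompactSupport g) (x : Rn n) :
    Tendsto (fun v => mixtureDensity (measureOfDensity g) v 1 x) (𝓝[>] 0) (𝓝 (g x)) := by
  obtain ⟨C, hC⟩ := hcs.exists_bound_of_continuous hc
  have hshift : ∀ v > 0, mixtureDensity (measureOfDensity g) v 1 x =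
      ∫ z, g (x - √v • z) ∂(stdGaussian (Rn n)) := by
    intro v hv
    have h1 : ∫ z, g (x - √v • z) ∂(stdGaussian (Rn n)) =
        ∫ z, g (x - z) ∂((stdGaussian (Rn n)).map fun z => √v • z) :=
      (integral_map (f := fun z => g (x - z)) (by fun_prop)
        (hc.comp (by fun_prop)).aestronglyMeasurable).symm
    rw [h1, map_smul_stdGaussian hv, mixtureDensity, measureOfDensity, measureOfDensity,
      integral_withDensity_eq_integral_toReal_smul
      (continuous_isoGaussianDensity v).measurable.ennreal_ofReal (by simp), integral_withDensity_eq_integral_toReal_smul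
      hc.measurable.ennreal_ofReal (by simp), ← integral_sub_left_eq_self _ _ x]
    refine integral_congr_ae (Eventually.of_forall fun z => ?_)
    simp only [one_smul, sub_sub_cancel, smul_eq_mul]
    rw [ENNReal.toReal_ofReal (hg.nonneg _), ENNReal.toReal_ofReal (isoGaussianDensity_nonneg hv _),
      mul_comm]
  have hlim : Tendsto (fun v : ℝ => ∫ z, g (x - √v • z) ∂(stdGaussian (Rn n))) (𝓝[>] 0)
      (𝓝 (∫ _, g x ∂(stdGaussian (Rn n)))) := by
    refine tendsto_integral_filter_of_dominated_convergence (fun _ => C)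
      (Eventually.of_forall fun v => (hc.comp (by fun_prop)).aestronglyMeasurable)
      (Eventually.of_forall fun v => Eventually.of_forall fun z => hC _) (integrable_const _)
      (Eventually.of_forall fun z => ?_)
    have hcv : Continuous fun v : ℝ => g (x - √v • z) := hc.comp (by fun_prop)
    have := hcv.tendsto 0
    simp only [Real.sqrt_zero, zero_smul, sub_zero] at this
    exact this.mono_left nhdsWithin_le_nhds
  rw [integral_const, probReal_univ, one_smul] at hlim
  refine hlim.congr' ?_
  filter_upwards [self_mem_nhdsWithin] with v hv
  exact (hshift v hv).symm

/-- Centres shrink to 0 and variances tend to 1; since the variance stays above `v`, the peak of the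
`𝒩(0, v)` density dominates for all `t ≥ 0`. -/
theorem tendsto_mixtureDensity_vp {μ : Measure (Rn n)} [IsProbabilityMeasure μ] {v : ℝ}
    (hv : 0 < v) (hv1 : v ≤ 1) (x : Rn n) :
    Tendsto (fun t => mixtureDensity μ (vpVar v t) (Real.exp (-t / 2)) x) atTop
      (𝓝 (isoGaussianDensity 1 x)) := by
  have he : Tendsto (fun t : ℝ => Real.exp (-t)) atTop (𝓝 0) := Real.tendsto_exp_neg_atTop_nhds_zero
  have he2 : Tendsto (fun t : ℝ => Real.exp (-t / 2)) atTop (𝓝 0) := by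
    have := he.comp (tendsto_id.atTop_div_const (two_pos (α := ℝ)))
    refine this.congr fun t => ?_
    simp [neg_div]
  have hV : Tendsto (vpVar v) atTop (𝓝 1) := by
    have := (he.mul_const v).add (he.const_sub 1)
    rw [zero_mul, sub_zero, zero_add] at this
    exact this
  have hlim : Tendsto (fun t => mixtureDensity μ (vpVar v t) (Real.exp (-t / 2)) x) atTop
      (𝓝 (∫ _, isoGaussianDensity 1 x ∂μ)) := by
    refine tendsto_integral_filter_of_dominated_convergence
      (fun _ => (2 * Real.pi * v) ^ (-(n : ℝ) / 2)) (Eventually.of_forall fun t =>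
        ((continuous_isoGaussianDensity _).comp (by fun_prop)).aestronglyMeasurable) ?_
      (integrable_const _) (Eventually.of_forall fun y => ?_)
    · filter_upwards [eventually_ge_atTop 0] with t ht
      refine Eventually.of_forall fun y => ?_
      have hpos := vpVar_pos hv ht
      rw [Real.norm_of_nonneg (isoGaussianDensity_nonneg hpos _)]
      refine (isoGaussianDensity_le hpos _).trans ?_
      have hle : v ≤ vpVar v t := le_vpVar hv1 ht
      refine Real.rpow_le_rpow_of_nonpos (by positivity) (by gcongr) ?_
      rw [neg_div, neg_nonpos]
      positivity
    · have hx : Tendsto (fun t : ℝ => x - Real.exp (-t / 2) • y) atTop (𝓝 x) := by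
        have := (he2.smul_const y).const_sub x
        simpa using this
      have hcst : Tendsto (fun t => (2 * Real.pi * vpVar v t) ^ (-(n : ℝ) / 2)) atTop
          (𝓝 ((2 * Real.pi * 1) ^ (-(n : ℝ) / 2))) :=
        (hV.const_mul _).rpow_const (Or.inl (by positivity))
      have hex : Tendsto (fun t => -‖x - Real.exp (-t / 2) • y‖ ^ 2 / (2 * vpVar v t)) atTop
          (𝓝 (-‖x‖ ^ 2 / (2 * 1))) :=
        (hx.norm.pow 2).neg.div (hV.const_mul 2) (by norm_num)
      exact hcst.mul ((Real.continuous_exp.tendsto _).comp hex)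
  simpa using hlim

/-- A `C¹` diffeomorphism pulls back a density to the density of the image measure under its
inverse, and preserves `L¹` distances. -/
theorem pullback_density {f g : Rn n → Rn n} (hfg : IsBiLipschitzC1Diffeo f g) {r : Rn n → ℝ}
    (hr : IsPDF r) (hrc : Continuous r) :
    IsPDF (fun x => r (f x) * |(fderiv ℝ f x).det|) ∧
      (measureOfDensity r).map g = measureOfDensity (fun x => r (f x) * |(fderiv ℝ f x).det|) ∧
      ∀ u : Rn n → ℝ, ∫ x, abs (u (f x) * |(fderiv ℝ f x).det| - r (f x) * |(fderiv ℝ f x).det|) =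
        ∫ x, |u x - r x| := by
  have hd : ∀ x, HasFDerivAt f (fderiv ℝ f x) x := fun x =>
    (hfg.contDiff.differentiable one_ne_zero x).hasFDerivAt
  have hinj : Function.Injective f := hfg.left_inv.injective
  have himg : f '' univ = univ := by
    rw [image_univ]; exact hfg.right_inv.surjective.range_eq
  have hdc : Continuous fun x => |(fderiv ℝ f x).det| :=
    (ContinuousLinearMap.continuous_det.comp (hfg.contDiff.continuous_fderiv one_ne_zero)).abs
  have hmap : (measureOfDensity r).map g =
      measureOfDensity (fun x => r (f x) * |(fderiv ℝ f x).det|) := by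
    ext s hs
    -- Writing the preimage as an image under `f` allows the change of variables formula.
    have hpre : g ⁻¹' s = f '' s :=
      (congrFun (image_eq_preimage_of_inverse hfg.left_inv hfg.right_inv) s).symm
    have hgm : Measurable g := hfg.contDiff_inv.continuous.measurable
    rw [Measure.map_apply hgm hs, measureOfDensity, withDensity_apply _ (hgm hs), hpre,
      lintegral_image_eq_lintegral_abs_det_fderiv_mul volume hs
        (fun x _ => (hd x).hasFDerivWithinAt) hinj.injOn, measureOfDensity, withDensity_apply _ hs]
    refine lintegral_congr fun x => ?_
    rw [mul_comm, ENNReal.ofReal_mul (hr.nonneg _)]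
  refine ⟨?_, hmap, fun u => ?_⟩
  · have := hr.isProbabilityMeasure
    have : IsProbabilityMeasure (measureOfDensity fun x => r (f x) * |(fderiv ℝ f x).det|) := by
      rw [← hmap]
      exact Measure.isProbabilityMeasure_map hfg.contDiff_inv.continuous.measurable.aemeasurable
    exact isPDF_of_measureOfDensity (fun x => mul_nonneg (hr.nonneg _) (abs_nonneg _))
      ((hrc.comp hfg.contDiff.continuous).mul hdc)
  · have h := integral_image_eq_integral_abs_det_fderiv_smul volume MeasurableSet.univ
      (fun x _ => (hd x).hasFDerivWithinAt) hinj.injOn (fun x => |u x - r x|)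
    rw [himg, Measure.restrict_univ] at h
    rw [h]
    refine integral_congr_ae (Eventually.of_forall fun x => ?_)
    simp only [smul_eq_mul]
    rw [← sub_mul, abs_mul, abs_abs, mul_comm]

theorem support_measureOfDensity_subset (g : Rn n → ℝ) :
    (measureOfDensity g).support ⊆ tsupport g := by
  refine Measure.support_subset_of_isClosed (isClosed_tsupport g) ?_
  rw [mem_ae_iff, measureOfDensity, withDensity_apply _ (isClosed_tsupport g).measurableSet.compl]
  refine (setLIntegral_congr_fun (isClosed_tsupport g).measurableSet.compl fun x hx => ?_).trans
    lintegral_zero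
  rw [image_eq_zero_of_notMem_tsupport hx, ENNReal.ofReal_zero]

theorem mixtureDensity_mem_GaussianConvolutions {μ : Measure (Rn n)} [IsProbabilityMeasure μ]
    (hμ : IsCompact μ.support) {v : ℝ} (hv : 0 < v) :
    mixtureDensity μ v 1 ∈ GaussianConvolutions n := by
  refine ⟨v • 1, μ, Matrix.PosDef.one.smul hv, inferInstance, hμ, ?_⟩
  ext x
  simp only [mixtureDensity, gaussianDensity_smul_one hv, one_smul]

theorem exists_ae_norm_le {μ : Measure (Rn n)} (hμ : IsCompact μ.support) :
    ∃ R : ℝ, ∀ᵐ y ∂μ, ‖y‖ ≤ R := by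
  obtain ⟨R, hR⟩ := hμ.isBounded.exists_norm_le
  exact ⟨R, Filter.mem_of_superset Measure.support_mem_ae hR⟩

end Approximation

end VPFlow

/-! ### The corollary. -/

theorem mainTheorem1 (n : ℕ) (pH : VPFlow.Rn n → ℝ) (hpH : VPFlow.IsPDF pH)
    (ε : ℝ) (hε : 0 < ε) :
    ∃ p ∈ VPFlow.GaussianConvolutions n, ∃ T : ℝ, 0 < T ∧
      ∃ φ : ℝ → VPFlow.Rn n → VPFlow.Rn n, VPFlow.IsProbabilityFlow p T φ ∧
      ∃ ψ : VPFlow.Rn n → VPFlow.Rn n, VPFlow.IsBiLipschitzC1Diffeo (φ T) ψ ∧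
        VPFlow.HasUniformlyLipschitzScores p T ∧
        ∃ q : VPFlow.Rn n → ℝ, VPFlow.IsPDF q ∧
          (stdGaussian (VPFlow.Rn n)).map ψ = VPFlow.measureOfDensity q ∧
          eLpNorm (fun x => pH x - q x) 1 volume < ENNReal.ofReal ε := by
  -- Three errors of `ε / 3`: from `pH` to `g`, from `g` to the mixture, and from the marginal at
  -- `T` to the Gaussian. The choices are successive: `g`, then `v`, then `T`.
  obtain ⟨g, hg, hgc, hgs, hge⟩ := VPFlow.exists_continuous_isPDF_near hpH
    (show 0 < ε / 3 by positivity)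
  have hμ := hg.isProbabilityMeasure
  set μ := VPFlow.measureOfDensity g with hμd
  have hsupp : IsCompact μ.support :=
    hgs.isCompact.of_isClosed_subset Measure.isClosed_support
      (VPFlow.support_measureOfDensity_subset g)
  obtain ⟨R, hR⟩ := VPFlow.exists_ae_norm_le hsupp
  obtain ⟨v, hvε, hv, hv1⟩ : ∃ v : ℝ, ∫ x, |VPFlow.mixtureDensity μ v 1 x - g x| < ε / 3 ∧
      0 < v ∧ v ≤ 1 := by
    have h := VPFlow.tendsto_integral_abs_sub_of_isPDF (l := nhdsWithin 0 (Ioi 0))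
      (by filter_upwards [self_mem_nhdsWithin] with v hv
          exact VPFlow.isPDF_mixtureDensity hv 1) hg
      (fun x => VPFlow.tendsto_mixtureDensity_zero hg hgc hgs x)
    exact ((h.eventually_lt_const (show 0 < ε / 3 by positivity)).and
      (Ioc_mem_nhdsGT one_pos)).exists
  obtain ⟨T, hTε, hT⟩ : ∃ T : ℝ, ∫ x, |VPFlow.mixtureDensity μ (VPFlow.vpVar v T)
      (Real.exp (-T / 2)) x - VPFlow.isoGaussianDensity 1 x| < ε / 3 ∧ 0 < T := by
    have h := VPFlow.tendsto_integral_abs_sub_of_isPDF (l := Filter.atTop)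
      (by filter_upwards [Filter.eventually_ge_atTop 0] with t ht
          exact VPFlow.isPDF_mixtureDensity (VPFlow.vpVar_pos hv ht) _)
      (VPFlow.isPDF_isoGaussianDensity one_pos)
      (fun x => VPFlow.tendsto_mixtureDensity_vp (μ := μ) hv hv1 x)
    exact ((h.eventually_lt_const (show 0 < ε / 3 by positivity)).and
      (Filter.eventually_gt_atTop 0)).exists
  obtain ⟨φ, ψ, hflow, hdiff, htr⟩ := VPFlow.exists_probabilityFlow hR hv hv1 hT.le
  have hp := VPFlow.isPDF_mixtureDensity (μ := μ) hv 1
  obtain ⟨hq, hmap, hL1⟩ := VPFlow.pullback_density hdiff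
    (VPFlow.isPDF_isoGaussianDensity one_pos) (VPFlow.continuous_isoGaussianDensity 1)
  refine ⟨_, VPFlow.mixtureDensity_mem_GaussianConvolutions hsupp hv, T, hT, φ, hflow, ψ, hdiff,
    (VPFlow.hasUniformlyLipschitzScores_mixtureDensity hR hv hv1 T).1, _, hq,
    by rw [VPFlow.stdGaussian_eq, hmap], ?_⟩
  set q : VPFlow.Rn n → ℝ :=
    fun x => VPFlow.isoGaussianDensity 1 (φ T x) * |(fderiv ℝ (φ T) x).det| with hqd
  have hpq : ∫ x, |VPFlow.mixtureDensity μ v 1 x - q x| < ε / 3 := by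
    -- Both densities are pullbacks along `φ T`, the mixture that of its own marginal, so their
    -- distance is the one measured at time `T`.
    have h := hL1 (VPFlow.vpDensity (VPFlow.mixtureDensity μ v 1) T)
    simp_rw [htr] at h
    rw [h, VPFlow.vpDensity_mixtureDensity hv hT.le]
    exact hTε
  have h1 := (hpH.integrable.sub hg.integrable).abs
  have h2 := (hp.integrable.sub hg.integrable).abs
  have h3 := (hp.integrable.sub hq.integrable).abs
  have htri : ∫ x, |pH x - q x| ≤ (∫ x, |pH x - g x|) +
      (∫ x, |VPFlow.mixtureDensity μ v 1 x - g x|) +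
      ∫ x, |VPFlow.mixtureDensity μ v 1 x - q x| := by
    have h12 := integral_add h1 h2
    have h123 := integral_add (h1.add h2) h3
    simp only [Pi.add_apply, Pi.sub_apply] at h12 h123
    rw [← h12, ← h123]
    refine integral_mono (hpH.integrable.sub hq.integrable).abs ((h1.add h2).add h3) fun x => ?_
    have e1 := abs_sub_le (pH x) (g x) (q x)
    have e2 := abs_sub_le (g x) (VPFlow.mixtureDensity μ v 1 x) (q x)
    rw [abs_sub_comm (g x) (VPFlow.mixtureDensity μ v 1 x)] at e2
    beta_reduce
    linarith
  have hnorm : eLpNorm (fun x => pH x - q x) 1 volume = ENNReal.ofReal (∫ x, |pH x - q x|) := by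
    rw [eLpNorm_one_eq_lintegral_enorm]
    exact (ofReal_integral_norm_eq_lintegral_enorm (hpH.integrable.sub hq.integrable)).symm
  rw [hnorm, ENNReal.ofReal_lt_ofReal_iff hε]
  linarith
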